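/- Let $v_1,v_2,v_3\in\mathbb R^2$ be non-collinear, let $\triangle=\mathrm{co}\{v_1,v_2,v_3\}$ be the closed triangle they span, $q$ its circumcenter, and $\varphi(y)=\min_{i} v_i\cdot y$. For $\varepsilon,t>0$ let $$u^\varepsilon_t(x)=-\varepsilon\log\Big(\frac1{2\pi\varepsilon t}\int_{\mathbb R^2}\exp\Big(-\frac{|x-y|^2}{2\varepsilon t}-\frac{\varphi(y)}\varepsilon\Big)dy\Big),$$ the Cole–Hopf solution of $\partial_tu+\frac12|\nabla u|^2=\frac\varepsilon2\Delta u$ with initial data $\varphi$. Let $t\mapsto X^\varepsilon_t(y)$, $t\ge0$, be the continuous path with $X^\varepsilon_0(y)=y$ and $\partial_tX^\varepsilon_t(y)=\nabla u^\varepsilon_t(X^\varepsilon_t(y))$ for all $t>0$; let $X_t(y)=\lim_{\varepsilon\to0^+}X^\varepsilon_t(y)$, and let $\rho_t=(X_t)_\sharp\mathrm{Leb}$ be the pushforward of Lebesgue measure. Let $w_t(x)=\sup_y\big(x\cdot y-\frac12|y|^2-t\varphi(y)\big)$, with subgradient $\partial w_t(x)=\{p: w_t(z)\ge w_t(x)+p\cdot(z-x)\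 \forall z\}$, and let $\mu_t$ be its Monge–Ampère measure, $\mu_t(B)=|\partial w_t(B)|$ for Borel sets $B$. These objects are well defined: for all $\varepsilon>0$ and $y$ the path $X^\varepsilon_t(y)$, $t\ge0$, exists and is unique; the limit $X_t(y)$ exists for all $t\ge0$ and $y$; $X_t$ is continuous for each $t\ge0$; and for each $t>0$ the set function $B\mapsto|\partial w_t(B)|$ is a Borel measure. Moreover the following are equivalent: (i) $q\in\triangle$; (ii) $\rho_t=\mu_t$ for all $t>0$; (iii) $\rho_t=\mu_t$ for some $t>0$. If $q\notin\triangle$, then for every $t>0$ the measure $\rho_t$ has no atoms: $\rho_t(\{x\})=0$ for all $x\in\mathbb R^2$. On the other hand, $\mu_t(\{tq\})>0$ for every $t>0$, whether or not $q\in\triangle$. -/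

import Mathlib

open MeasureTheory Filter Topology Set

noncomputable section

namespace Adhesion

/-- The Cole-Hopf potential
`u^ε_t(x) = -ε log ((2πεt)^{-d/2} ∫ exp (-|x-y|²/(2εt) - φ(y)/ε) dy)`, the solution of
`∂ₜu + |∇u|²/2 = (ε/2) Δu` with initial data `φ`. -/
def viscousPotential {d : ℕ} (φ : EuclideanSpace ℝ (Fin d) → ℝ) (ε t : ℝ)
    (x : EuclideanSpace ℝ (Fin d)) : ℝ :=
  -ε * Real.log (1 / (2 * Real.pi * ε * t) ^ ((d : ℝ) / 2) *
    ∫ y, Real.exp (-‖x - y‖ ^ 2 / (2 * ε * t) - φ y / ε))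

/-- `z` is the trajectory from `y`, on `[0, ∞)`, of the viscous velocity field
`v^ε = ∇u^ε`. The field is smooth only for `t > 0`, so the equation is required there and
`z` is required to be continuous up to `t = 0`. -/
def IsViscousPath {d : ℕ} (φ : EuclideanSpace ℝ (Fin d) → ℝ) (ε : ℝ)
    (y : EuclideanSpace ℝ (Fin d)) (z : ℝ → EuclideanSpace ℝ (Fin d)) : Prop :=
  z 0 = y ∧ ContinuousOn z (Ici 0) ∧
    ∀ t, 0 < t → HasDerivAt z (gradient (viscousPotential φ ε t) (z t)) t

/-- The viscous Lagrangian flow map `X^ε_t(y)`. -/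
def viscousFlow {d : ℕ} (φ : EuclideanSpace ℝ (Fin d) → ℝ) (ε t : ℝ)
    (y : EuclideanSpace ℝ (Fin d)) : EuclideanSpace ℝ (Fin d) :=
  Classical.epsilon (IsViscousPath φ ε y) t

/-- The Lagrangian flow map of the adhesion model, `X_t(y) = lim_{ε → 0+} X^ε_t(y)`. -/
def lagrangianFlow {d : ℕ} (φ : EuclideanSpace ℝ (Fin d) → ℝ) (t : ℝ)
    (y : EuclideanSpace ℝ (Fin d)) : EuclideanSpace ℝ (Fin d) :=
  limUnder (𝓝[>] (0 : ℝ)) (fun ε => viscousFlow φ ε t y)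

/-- The mass distribution `ρ_t`, the pushforward of Lebesgue measure under `X_t`. -/
def massMeasure {d : ℕ} (φ : EuclideanSpace ℝ (Fin d) → ℝ) (t : ℝ) :
    Measure (EuclideanSpace ℝ (Fin d)) :=
  Measure.map (lagrangianFlow φ t) volume

/-- The convex potential `w_t(x) = sup_y (x·y - |y|²/2 - t φ(y))`. -/
def convexPotential {d : ℕ} (φ : EuclideanSpace ℝ (Fin d) → ℝ) (t : ℝ)
    (x : EuclideanSpace ℝ (Fin d)) : ℝ :=
  ⨆ y : EuclideanSpace ℝ (Fin d), (inner ℝ x y - ‖y‖ ^ 2 / 2 - t * φ y)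

/-- The subgradient `∂w(x)`. -/
def subgradient {d : ℕ} (w : EuclideanSpace ℝ (Fin d) → ℝ) (x : EuclideanSpace ℝ (Fin d)) :
    Set (EuclideanSpace ℝ (Fin d)) :=
  {p | ∀ z, w x + inner ℝ p (z - x) ≤ w z}

/-- `μ` is the Monge-Ampère measure of `w`: `μ(B) = |∂w(B)|` for all Borel sets `B`. -/
def IsMongeAmpereMeasure {d : ℕ} (w : EuclideanSpace ℝ (Fin d) → ℝ)
    (μ : Measure (EuclideanSpace ℝ (Fin d))) : Prop :=
  ∀ B, MeasurableSet B → μ B = volume (⋃ x ∈ B, subgradient w x)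

/-- The Monge-Ampère measure of `w`. -/
def mongeAmpere {d : ℕ} (w : EuclideanSpace ℝ (Fin d) → ℝ) :
    Measure (EuclideanSpace ℝ (Fin d)) :=
  Classical.epsilon (IsMongeAmpereMeasure w)

/-- The three-sector initial velocity potential `φ(y) = min_i v_i·y`. -/
def threeSector (v : Fin 3 → EuclideanSpace ℝ (Fin 2)) (y : EuclideanSpace ℝ (Fin 2)) : ℝ :=
  Finset.univ.inf' Finset.univ_nonempty (fun i => inner ℝ (v i) y)

end Adhesion

end

/-!
The centre `q` is equidistant from the `v i`, so in the frame moving with velocity `q` the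
zero-viscosity potential is the stationary concave function `f = min_i ⟪v i - q, ·⟫`, up to a
function of time. The Cole-Hopf potential stays within `ε log 3` of it and is concave, so its
gradient is a supergradient of `f` up to this error. Hence `‖X^ε - X^ε'‖²` grows at most linearly
at the rate `2 (ε + ε') log 3`, and the viscous flows converge to the nonexpansive gradient flow
of `f`, which is homogeneous because `f` is.

Completing the square, `y ∈ ∂w_t(x + tq)` says that `x` is the resolvent of `t f` at `y`. If
`q ∈ △` then `f` is affine with slope `‖p‖²` for a short time along a supergradient `p` at each
point, which makes the flow coincide with the resolvent. If `q ∉ △` then `f` has a positive slope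
along the common edge of two of its sectors, trajectories are drawn onto this ray and drift along
it forever, and no fibre of the flow has positive measure. In contrast, the subgradient of `w_t`
at `tq` always contains the set `-t (△ - q)` of positive area.
-/

noncomputable section

namespace Adhesion

theorem eq_of_norm_sub_sq_nonpos {E : Type*} [NormedAddCommGroup E] {x y : E}
    (h : ‖x - y‖ ^ 2 ≤ 0) : x = y :=
  sub_eq_zero.mp (norm_eq_zero.mp (sq_nonpos_iff _ |>.mp h))

theorem norm_sub_sq_le_of_tendsto {E : Type*} [NormedAddCommGroup E] {z₁ z₂ : ℝ → E} {x₁ x₂ : E}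
    {g : ℝ → ℝ} (h₁ : Tendsto z₁ (𝓝[>] 0) (𝓝 x₁)) (h₂ : Tendsto z₂ (𝓝[>] 0) (𝓝 x₂))
    (hg : Continuous g) (h : ∀ δ > 0, ‖z₁ δ - z₂ δ‖ ^ 2 ≤ g δ) : ‖x₁ - x₂‖ ^ 2 ≤ g 0 :=
  le_of_tendsto_of_tendsto ((h₁.sub h₂).norm.pow 2)
    ((hg.tendsto 0).mono_left nhdsWithin_le_nhds) (eventually_mem_nhdsWithin.mono h)

section GradientFlow

variable {E : Type*} [NormedAddCommGroup E] [InnerProductSpace ℝ E]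

/-- `p` is a supergradient of `f` at `x` up to an error `δ`. -/
def IsSupergradient (f : E → ℝ) (δ : ℝ) (x p : E) : Prop :=
  ∀ w, f w ≤ f x + inner ℝ p (w - x) + δ

theorem isSupergradient_of_le_inner {f : E → ℝ} {x p : E} (hle : ∀ w, f w ≤ inner ℝ p w)
    (hx : inner ℝ p x ≤ f x) : IsSupergradient f 0 x p := fun w => by
  rw [inner_sub_right]
  linarith [hle w]

theorem IsSupergradient.inner_sub_sub_le {f : E → ℝ} {x₁ x₂ p₁ p₂ : E} {δ₁ δ₂ : ℝ}
    (h₁ : IsSupergradient f δ₁ x₁ p₁) (h₂ : IsSupergradient f δ₂ x₂ p₂) :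
    inner ℝ (p₁ - p₂) (x₁ - x₂) ≤ δ₁ + δ₂ := by
  have h₁ := h₁ x₂
  have h₂ := h₂ x₁
  simp only [inner_sub_left, inner_sub_right] at h₁ h₂ ⊢
  linarith

theorem norm_sub_sq_le_of_inner_deriv_le {z₁ z₂ : ℝ → E} {δ T : ℝ}
    (h₁ : ContinuousOn z₁ (Icc 0 T)) (h₂ : ContinuousOn z₂ (Icc 0 T))
    (hder : ∀ t ∈ Ioo 0 T, ∃ p₁ p₂, HasDerivAt z₁ p₁ t ∧ HasDerivAt z₂ p₂ t ∧
      inner ℝ (p₁ - p₂) (z₁ t - z₂ t) ≤ δ) {t : ℝ} (ht : t ∈ Icc 0 T) :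
    ‖z₁ t - z₂ t‖ ^ 2 ≤ ‖z₁ 0 - z₂ 0‖ ^ 2 + 2 * δ * t := by
  have hder' : ∀ s ∈ Ioo 0 T, ∃ g', g' ≤ 0 ∧
      HasDerivAt (fun s => ‖z₁ s - z₂ s‖ ^ 2 - 2 * δ * s) g' s := by
    intro s hs
    obtain ⟨p₁, p₂, hp₁, hp₂, hp⟩ := hder s hs
    refine ⟨_, ?_, ((hp₁.sub hp₂).norm_sq).sub ((hasDerivAt_id s).const_mul (2 * δ))⟩
    rw [real_inner_comm] at hp
    simp only [Pi.sub_apply]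
    linarith
  have hanti : AntitoneOn (fun s => ‖z₁ s - z₂ s‖ ^ 2 - 2 * δ * s) (Icc 0 T) := by
    refine antitoneOn_of_deriv_nonpos (convex_Icc 0 T)
      ((h₁.sub h₂).norm.pow 2 |>.sub (by fun_prop)) ?_ ?_ <;> rw [interior_Icc] <;> intro s hs
    · obtain ⟨g', -, hg⟩ := hder' s hs
      exact hg.differentiableAt.differentiableWithinAt
    · obtain ⟨g', hg0, hg⟩ := hder' s hs
      rwa [hg.deriv]
  have := hanti ⟨le_rfl, ht.1.trans ht.2⟩ ht ht.1
  simp only [mul_zero, sub_zero] at this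
  linarith

/-- `z` is a path on `[0, T]` whose velocity is a supergradient of `f` up to an error `δ`. -/
def IsApproxGradientPath (f : E → ℝ) (δ T : ℝ) (z : ℝ → E) : Prop :=
  ContinuousOn z (Icc 0 T) ∧
    ∀ t ∈ Ioo 0 T, ∃ p, HasDerivAt z p t ∧ IsSupergradient f δ (z t) p

theorem isApproxGradientPath_segment {f : E → ℝ} {x p : E} {T : ℝ}
    (h : ∀ t ∈ Ioo 0 T, IsSupergradient f 0 (x + t • p) p) :
    IsApproxGradientPath f 0 T (fun t => x + t • p) :=
  ⟨by fun_prop, fun t ht =>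
    ⟨p, by simpa using ((hasDerivAt_id t).smul_const p).const_add x, h t ht⟩⟩

namespace IsApproxGradientPath

variable {f : E → ℝ} {δ T : ℝ} {z : ℝ → E}

theorem norm_sub_sq_le {δ' : ℝ} {z' : ℝ → E} (h : IsApproxGradientPath f δ T z)
    (h' : IsApproxGradientPath f δ' T z') {t : ℝ} (ht : t ∈ Icc 0 T) :
    ‖z t - z' t‖ ^ 2 ≤ ‖z 0 - z' 0‖ ^ 2 + 2 * (δ + δ') * t := by
  refine norm_sub_sq_le_of_inner_deriv_le h.1 h'.1 (fun s hs => ?_) ht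
  obtain ⟨p, hp, hf⟩ := h.2 s hs
  obtain ⟨p', hp', hf'⟩ := h'.2 s hs
  exact ⟨p, p', hp, hp', hf.inner_sub_sub_le hf'⟩

theorem mono {δ' : ℝ} (h : IsApproxGradientPath f δ T z) (hδ : δ ≤ δ') :
    IsApproxGradientPath f δ' T z :=
  ⟨h.1, fun t ht => (h.2 t ht).imp fun _ hp => ⟨hp.1, fun w => (hp.2 w).trans (by gcongr)⟩⟩

theorem shift {τ : ℝ} (h : IsApproxGradientPath f δ (τ + T) z) (hτ : 0 ≤ τ) :
    IsApproxGradientPath f δ T (fun t => z (τ + t)) := by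
  refine ⟨h.1.comp (by fun_prop) fun t ht => ⟨by linarith [ht.1], by linarith [ht.2]⟩,
    fun t ht => ?_⟩
  obtain ⟨p, hp, hf⟩ := h.2 (τ + t) ⟨by linarith [ht.1], by linarith [ht.2]⟩
  exact ⟨p, hp.comp_const_add τ t, hf⟩

theorem rescale (h : IsApproxGradientPath f δ T z)
    (hf : ∀ a : ℝ, 0 < a → ∀ x, f (a • x) = a * f x) {a : ℝ} (ha : 0 < a) :
    IsApproxGradientPath f (a * δ) (a * T) (fun t => a • z (t / a)) := by
  refine ⟨(h.1.comp (by fun_prop) fun t ht => ?_).const_smul a, fun t ht => ?_⟩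
  · exact ⟨div_nonneg ht.1 ha.le, by rw [div_le_iff₀ ha]; linarith [ht.2]⟩
  obtain ⟨p, hp, hw⟩ := h.2 (t / a) ⟨div_pos ht.1 ha, by rw [div_lt_iff₀ ha]; linarith [ht.2]⟩
  refine ⟨p, ?_, fun w => ?_⟩
  · have hder := (hp.scomp t ((hasDerivAt_id t).div_const a)).const_smul a
    rwa [smul_smul, mul_one_div_cancel ha.ne', one_smul] at hder
  · have hw := mul_le_mul_of_nonneg_left (hw (a⁻¹ • w)) ha.le
    have hinner : a * inner ℝ p (a⁻¹ • w - z (t / a)) = inner ℝ p (w - a • z (t / a)) := by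
      rw [← real_inner_smul_right, smul_sub, smul_inv_smul₀ ha.ne']
    rw [mul_add, mul_add, ← hf a ha, smul_inv_smul₀ ha.ne', hinner, ← hf a ha] at hw
    exact hw

end IsApproxGradientPath

/-- `S` is the gradient flow `∂ₜ S_t ∈ ∂⁺f (S_t)` of a concave function `f`, encoded by
approximation: its orbits are limits of approximate gradient paths. -/
def IsGradientFlow (f : E → ℝ) (S : ℝ → E → E) : Prop :=
  ∀ y, ∃ z : ℝ → ℝ → E, (∀ δ > 0, z δ 0 = y ∧ ∀ T, IsApproxGradientPath f δ T (z δ)) ∧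
    ∀ t, 0 ≤ t → Tendsto (fun δ => z δ t) (𝓝[>] 0) (𝓝 (S t y))

namespace IsGradientFlow

variable {f : E → ℝ} {S : ℝ → E → E}

theorem norm_sub_le (hS : IsGradientFlow f S) {t : ℝ} (ht : 0 ≤ t) (y₁ y₂ : E) :
    ‖S t y₁ - S t y₂‖ ≤ ‖y₁ - y₂‖ := by
  obtain ⟨z₁, hz₁, hlim₁⟩ := hS y₁
  obtain ⟨z₂, hz₂, hlim₂⟩ := hS y₂
  have hsq := norm_sub_sq_le_of_tendsto (g := fun δ => ‖y₁ - y₂‖ ^ 2 + 2 * (δ + δ) * t)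
    (hlim₁ t ht) (hlim₂ t ht) (by fun_prop) fun δ hδ => by
      simpa only [(hz₁ δ hδ).1, (hz₂ δ hδ).1] using
        ((hz₁ δ hδ).2 t).norm_sub_sq_le ((hz₂ δ hδ).2 t) ⟨ht, le_rfl⟩
  exact le_of_sq_le_sq (by simpa using hsq) (norm_nonneg _)

theorem continuous (hS : IsGradientFlow f S) {t : ℝ} (ht : 0 ≤ t) : Continuous (S t) :=
  (LipschitzWith.of_dist_le_mul (K := 1) fun y₁ y₂ => by
    simpa [dist_eq_norm] using hS.norm_sub_le ht y₁ y₂).continuous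

theorem norm_path_sub_sq_le (hS : IsGradientFlow f S) {δ T : ℝ} {z : ℝ → E}
    (hz : IsApproxGradientPath f δ T z) {t : ℝ} (ht : t ∈ Icc 0 T) :
    ‖z t - S t (z 0)‖ ^ 2 ≤ 2 * δ * t := by
  obtain ⟨z', hz', hlim⟩ := hS (z 0)
  have hsq := norm_sub_sq_le_of_tendsto (g := fun η => 2 * (δ + η) * t) tendsto_const_nhds
    (hlim t ht.1) (by fun_prop) fun η hη => by
      simpa [(hz' η hη).1] using hz.norm_sub_sq_le ((hz' η hη).2 T) ht
  simpa using hsq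

theorem eq_of_path (hS : IsGradientFlow f S) {T : ℝ} {z : ℝ → E}
    (hz : IsApproxGradientPath f 0 T z) {t : ℝ} (ht : t ∈ Icc 0 T) : S t (z 0) = z t :=
  (eq_of_norm_sub_sq_nonpos (by simpa using hS.norm_path_sub_sq_le hz ht)).symm

theorem eq_segment (hS : IsGradientFlow f S) {x p : E} {T : ℝ} (hT : 0 ≤ T)
    (h : ∀ t ∈ Ioo 0 T, IsSupergradient f 0 (x + t • p) p) : S T x = x + T • p := by
  simpa using hS.eq_of_path (isApproxGradientPath_segment h) ⟨hT, le_rfl⟩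

theorem map_zero (hS : IsGradientFlow f S) (y : E) : S 0 y = y := by
  simpa using hS.eq_segment (x := y) (p := 0) le_rfl (by simp)

theorem map_add (hS : IsGradientFlow f S) {τ t : ℝ} (hτ : 0 ≤ τ) (ht : 0 ≤ t) (y : E) :
    S (τ + t) y = S t (S τ y) := by
  obtain ⟨z, hz, hlim⟩ := hS y
  refine eq_of_norm_sub_sq_nonpos ?_
  have hsq := norm_sub_sq_le_of_tendsto (g := fun δ => 2 * δ * t)
    (hlim (τ + t) (by positivity)) (((hS.continuous ht).tendsto _).comp (hlim τ hτ))
    (by fun_prop) fun δ hδ => by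
      simpa using hS.norm_path_sub_sq_le (((hz δ hδ).2 (τ + t)).shift hτ) ⟨ht, le_rfl⟩
  simpa using hsq

theorem map_smul (hS : IsGradientFlow f S) (hf : ∀ a : ℝ, 0 < a → ∀ x, f (a • x) = a * f x)
    {a t : ℝ} (ha : 0 < a) (ht : 0 ≤ t) (y : E) : S (a * t) (a • y) = a • S t y := by
  obtain ⟨z, hz, hlim⟩ := hS y
  refine (eq_of_norm_sub_sq_nonpos ?_).symm
  have hsq := norm_sub_sq_le_of_tendsto (g := fun δ => 2 * (a * δ) * (a * t))
    ((hlim t ht).const_smul a) tendsto_const_nhds (by fun_prop) fun δ hδ => by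
      simpa [(hz δ hδ).1, mul_div_cancel_left₀ t ha.ne'] using hS.norm_path_sub_sq_le
        (((hz δ hδ).2 t).rescale hf ha) (t := a * t) ⟨by positivity, le_rfl⟩
  simpa using hsq

theorem continuousOn_time (hS : IsGradientFlow f S) (y : E) :
    ContinuousOn (fun t => S t y) (Ici 0) := by
  obtain ⟨z, hz, -⟩ := hS y
  refine continuousOn_of_locally_continuousOn fun t _ => ⟨Iio (t + 1), isOpen_Iio, by simp, ?_⟩
  have hunif : TendstoUniformlyOn z (fun s => S s y) (𝓝[>] 0) (Icc 0 (t + 1)) := by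
    rw [Metric.tendstoUniformlyOn_iff]
    intro η hη
    have hlim : Tendsto (fun δ : ℝ => 2 * δ * (t + 1)) (𝓝[>] 0) (𝓝 0) := by
      have hcont : Continuous fun δ : ℝ => 2 * δ * (t + 1) := by fun_prop
      simpa using (hcont.tendsto 0).mono_left nhdsWithin_le_nhds
    filter_upwards [hlim.eventually_lt_const (pow_pos hη 2), self_mem_nhdsWithin] with δ hδ hδ0 s hs
    have hδ0 : 0 < δ := hδ0
    have hsq := hS.norm_path_sub_sq_le ((hz δ hδ0).2 (t + 1)) hs
    rw [(hz δ hδ0).1] at hsq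
    rw [dist_comm, dist_eq_norm]
    refine lt_of_pow_lt_pow_left₀ 2 hη.le (hsq.trans_lt (hδ.trans_le' ?_))
    gcongr
    exact hs.2
  refine (hunif.continuousOn (Eventually.frequently ?_)).mono fun s hs => ⟨hs.1, hs.2.le⟩
  filter_upwards [self_mem_nhdsWithin] with δ hδ using ((hz δ hδ).2 (t + 1)).1

end IsGradientFlow

end GradientFlow

section Resolvent

variable {E : Type*} [NormedAddCommGroup E] [InnerProductSpace ℝ E] {f : E → ℝ} {t : ℝ}

/-- `x` is the image of `y` under the backward Euler step of size `t` for `f`: `(x - y) / t` is a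
supergradient of `f` at `x`, written without the division so that `t = 0` gives `x = y`. -/
def IsResolvent (f : E → ℝ) (t : ℝ) (y x : E) : Prop :=
  ∀ w, t * f w ≤ t * f x + inner ℝ (x - y) (w - x)

namespace IsResolvent

theorem norm_sub_le {y₁ y₂ x₁ x₂ : E} (h₁ : IsResolvent f t y₁ x₁) (h₂ : IsResolvent f t y₂ x₂) :
    ‖x₁ - x₂‖ ≤ ‖y₁ - y₂‖ := by
  have hsq : ‖x₁ - x₂‖ ^ 2 ≤ inner ℝ (y₁ - y₂) (x₁ - x₂) := by
    have h₁ := h₁ x₂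
    have h₂ := h₂ x₁
    rw [← real_inner_self_eq_norm_sq]
    simp only [inner_sub_left, inner_sub_right] at h₁ h₂ ⊢
    linarith
  have hCS := real_inner_le_norm (y₁ - y₂) (x₁ - x₂)
  by_contra! hlt
  nlinarith [norm_nonneg (y₁ - y₂), norm_nonneg (x₁ - x₂)]

theorem unique {y x₁ x₂ : E} (h₁ : IsResolvent f t y x₁) (h₂ : IsResolvent f t y x₂) :
    x₁ = x₂ := by
  simpa [sub_eq_zero] using h₁.norm_sub_le h₂

/-- Moving with velocity `p` agrees with the resolvent step because the segment through `x` in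
direction `p` is straight on both sides of `x`, which forces `⟪x - y, p⟫ = t * ‖p‖ ^ 2`. -/
theorem add_smul {y x p : E} {h : ℝ} (hx : IsResolvent f t y x) (hp : IsSupergradient f 0 x p)
    (hh : 0 ≤ h) (hfwd : f (x + h • p) = f x + h * ‖p‖ ^ 2)
    (hbwd : f (x + -h • p) = f x + -h * ‖p‖ ^ 2) :
    IsResolvent f (t + h) y (x + h • p) := by
  intro w
  have hw := hx w
  have hstep : h * inner ℝ (x - y) p ≤ h * (t * ‖p‖ ^ 2) := by
    have := hx (x + -h • p)
    rw [hbwd, add_sub_cancel_left, real_inner_smul_right] at this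
    linarith
  have hpw := mul_le_mul_of_nonneg_left (hp w) hh
  have hinner : inner ℝ (x + h • p - y) (w - (x + h • p)) = inner ℝ (x - y) (w - x)
      - h * inner ℝ (x - y) p + h * inner ℝ p (w - x) - h * (h * ‖p‖ ^ 2) := by
    rw [← real_inner_self_eq_norm_sq]
    simp only [inner_sub_right, inner_sub_left, inner_add_left, inner_add_right,
      real_inner_smul_left, real_inner_smul_right]
    ring
  rw [hfwd, hinner]
  linarith

end IsResolvent

theorem isClosed_setOf_isResolvent (hf : Continuous f) {y : E} {z : ℝ → E} {s : Set ℝ}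
    (hs : IsClosed s) (hz : ContinuousOn z s) :
    IsClosed ({t | IsResolvent f t y (z t)} ∩ s) := by
  have hset : {t | IsResolvent f t y (z t)} ∩ s =
      s ∩ ⋂ w, {t ∈ s | t * f w ≤ t * f (z t) + inner ℝ (z t - y) (w - z t)} := by
    ext t
    simp only [IsResolvent, mem_inter_iff, mem_ofPred_eq, mem_iInter]
    exact ⟨fun h => ⟨h.2, fun w => ⟨h.2, h.1 w⟩⟩, fun h => ⟨fun w => (h.2 w).2, h.1⟩⟩
  rw [hset]
  exact hs.inter <| isClosed_iInter fun w => hs.isClosed_le (by fun_prop) (by fun_prop)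

variable {S : ℝ → E → E}

theorem IsGradientFlow.eq_add_smul (hS : IsGradientFlow f S) {x p : E} {h : ℝ} (hh : 0 ≤ h)
    (hp : IsSupergradient f 0 x p)
    (hlin : ∀ s ∈ Ioo 0 h, f (x + s • p) = f x + s * ‖p‖ ^ 2) : S h x = x + h • p := by
  refine hS.eq_segment hh fun s hs w => (hp w).trans_eq ?_
  rw [hlin s hs, ← sub_sub, inner_sub_right p (w - x), real_inner_smul_right,
    real_inner_self_eq_norm_sq]
  ring

theorem IsGradientFlow.isResolvent (hS : IsGradientFlow f S) (hf : Continuous f)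
    (hlin : ∀ x, ∃ p, IsSupergradient f 0 x p ∧
      ∀ᶠ h in 𝓝 (0 : ℝ), f (x + h • p) = f x + h * ‖p‖ ^ 2) {T : ℝ} (hT : 0 ≤ T) (y : E) :
    IsResolvent f T y (S T y) := by
  suffices Icc 0 T ⊆ {t | IsResolvent f t y (S t y)} from this ⟨hT, le_rfl⟩
  refine IsClosed.Icc_subset_of_forall_mem_nhdsWithin ?_ (by simp [IsResolvent, hS.map_zero]) ?_
  · exact isClosed_setOf_isResolvent hf isClosed_Icc
      ((hS.continuousOn_time y).mono Icc_subset_Ici_self)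
  rintro t ⟨ht, ht0, -⟩
  obtain ⟨p, hp, hlin⟩ := hlin (S t y)
  obtain ⟨η, hη, hlin⟩ := Metric.eventually_nhds_iff.mp hlin
  simp only [Real.dist_0_eq_abs] at hlin
  filter_upwards [Ioo_mem_nhdsGT (lt_add_of_pos_right t hη)] with r hr
  obtain ⟨h, rfl⟩ : ∃ h, r = t + h := ⟨r - t, by ring⟩
  have hh0 : 0 < h := by linarith [hr.1]
  have hhη : h < η := by linarith [hr.2]
  have hflow : S h (S t y) = S t y + h • p := hS.eq_add_smul hh0.le hp fun s hs =>
    hlin (by rw [abs_of_pos hs.1]; exact hs.2.trans hhη)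
  change IsResolvent f (t + h) y (S (t + h) y)
  rw [hS.map_add ht0 hh0.le, hflow]
  exact IsResolvent.add_smul ht hp hh0.le (hlin (by rwa [abs_of_pos hh0]))
    (hlin (by rwa [abs_neg, abs_of_pos hh0]))

end Resolvent

theorem nonpos_of_forall_mul_le {c C : ℝ} (h : ∀ s : ℝ, 0 ≤ s → s * c ≤ C) : c ≤ 0 := by
  by_contra! hc
  have := h ((|C| + 1) / c) (by positivity)
  rw [div_mul_cancel₀ _ hc.ne'] at this
  linarith [le_abs_self C]

section Drift

variable {E : Type*} [NormedAddCommGroup E] [InnerProductSpace ℝ E]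

theorem eq_zero_of_norm_add_smul_le {x u : E} {C : ℝ} (h : ∀ s : ℝ, 0 ≤ s → ‖x + s • u‖ ≤ C) :
    u = 0 := by
  refine norm_le_zero_iff.mp (nonpos_of_forall_mul_le (C := C + ‖x‖) fun s hs => ?_)
  calc s * ‖u‖ = ‖(x + s • u) - x‖ := by
        rw [add_sub_cancel_left, norm_smul, Real.norm_of_nonneg hs]
    _ ≤ ‖x + s • u‖ + ‖x‖ := norm_sub_le _ _
    _ ≤ C + ‖x‖ := by gcongr; exact h s hs

theorem inner_le_inner_of_norm_sub_smul_le {a y m : E}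
    (h : ∀ s : ℝ, 0 ≤ s → ‖a - s • m‖ ≤ ‖y - s • m‖) : inner ℝ m y ≤ inner ℝ m a := by
  suffices 2 * (inner ℝ m y - inner ℝ m a) ≤ 0 by linarith
  refine nonpos_of_forall_mul_le (C := ‖y‖ ^ 2 - ‖a‖ ^ 2) fun s hs => ?_
  have hsq : ‖a - s • m‖ ^ 2 ≤ ‖y - s • m‖ ^ 2 := by gcongr; exact h s hs
  rw [norm_sub_sq_real, norm_sub_sq_real, real_inner_smul_right, real_inner_smul_right,
    real_inner_comm, real_inner_comm m] at hsq
  linarith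

/-- `f` is bounded above by the minimum of the linear functions with gradients `m ± e`, where
`m ⟂ e` and `m ≠ 0`, and equals this minimum on the half-space `{x | 0 ≤ ⟪m, x⟫}`. The gradient
flow then drains this half-space into the ray through `m`. -/
structure IsDriftFrame (f : E → ℝ) (m e : E) : Prop where
  ne_zero : m ≠ 0
  orthogonal : inner ℝ m e = 0
  le : ∀ w, f w ≤ inner ℝ m w - |inner ℝ e w|
  ge : ∀ w, 0 ≤ inner ℝ m w → inner ℝ m w - |inner ℝ e w| ≤ f w

namespace IsDriftFrame

variable {f : E → ℝ} {m e : E} {S : ℝ → E → E} {t : ℝ} {y : E}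

theorem neg (h : IsDriftFrame f m e) : IsDriftFrame f m (-e) where
  ne_zero := h.ne_zero
  orthogonal := by simpa using h.orthogonal
  le := by simpa using h.le
  ge := by simpa using h.ge

theorem orthogonal' (h : IsDriftFrame f m e) : inner ℝ e m = 0 :=
  (real_inner_comm m e).trans h.orthogonal

theorem isSupergradient_mid (h : IsDriftFrame f m e) (hm : 0 ≤ inner ℝ m y)
    (he : inner ℝ e y = 0) : IsSupergradient f 0 y m :=
  isSupergradient_of_le_inner (fun w => by linarith [h.le w, abs_nonneg (inner ℝ e w)])
    (by simpa [he] using h.ge y hm)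

theorem isSupergradient_side (h : IsDriftFrame f m e) (hm : 0 ≤ inner ℝ m y)
    (he : 0 ≤ inner ℝ e y) : IsSupergradient f 0 y (m - e) :=
  isSupergradient_of_le_inner
    (fun w => by rw [inner_sub_left]; linarith [h.le w, le_abs_self (inner ℝ e w)])
    (by simpa [inner_sub_left, abs_of_nonneg he] using h.ge y hm)

theorem flow_eq_mid (h : IsDriftFrame f m e) (hS : IsGradientFlow f S) (ht : 0 ≤ t)
    (hm : 0 ≤ inner ℝ m y) (he : inner ℝ e y = 0) : S t y = y + t • m := by
  refine hS.eq_segment ht fun r hr => h.isSupergradient_mid ?_ ?_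
  · rw [inner_add_right, real_inner_smul_right, real_inner_self_eq_norm_sq]
    have := hr.1
    positivity
  · rw [inner_add_right, real_inner_smul_right, h.orthogonal', he]
    simp

theorem flow_eq_side (h : IsDriftFrame f m e) (hS : IsGradientFlow f S) (ht : 0 ≤ t)
    (hm : 0 ≤ inner ℝ m y) (he : t * ‖e‖ ^ 2 ≤ inner ℝ e y) : S t y = y + t • (m - e) := by
  refine hS.eq_segment ht fun r hr => h.isSupergradient_side ?_ ?_
  · rw [inner_add_right, real_inner_smul_right, inner_sub_right, real_inner_self_eq_norm_sq,
      h.orthogonal, sub_zero]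
    have := hr.1
    positivity
  · rw [inner_add_right, real_inner_smul_right, inner_sub_right, real_inner_self_eq_norm_sq,
      h.orthogonal']
    nlinarith [hr.2, sq_nonneg ‖e‖]

theorem flow_smul (h : IsDriftFrame f m e) (hS : IsGradientFlow f S) {s : ℝ} (hs : 0 ≤ s)
    (ht : 0 ≤ t) : S t (s • m) = (s + t) • m := by
  rw [h.flow_eq_mid hS ht, add_smul]
  · rw [real_inner_smul_right, real_inner_self_eq_norm_sq]
    positivity
  · rw [real_inner_smul_right, h.orthogonal', mul_zero]

/-- Nonexpansiveness, tested against the far end of the ray through `m`. -/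
theorem le_inner_flow (h : IsDriftFrame f m e) (hS : IsGradientFlow f S) (ht : 0 ≤ t) (y : E) :
    inner ℝ m y + t * ‖m‖ ^ 2 ≤ inner ℝ m (S t y) := by
  have hray : inner ℝ m y ≤ inner ℝ m (S t y - t • m) :=
    inner_le_inner_of_norm_sub_smul_le fun s hs => by
      rw [sub_sub, ← add_smul, add_comm t, ← h.flow_smul hS hs ht]
      exact hS.norm_sub_le ht y (s • m)
  rw [inner_sub_right, real_inner_smul_right, real_inner_self_eq_norm_sq] at hray
  linarith

theorem inner_flow (h : IsDriftFrame f m e) (hS : IsGradientFlow f S) (ht : 0 ≤ t)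
    (hm : 0 ≤ inner ℝ m y) : inner ℝ m (S t y) = inner ℝ m y + t * ‖m‖ ^ 2 := by
  wlog he : 0 ≤ inner ℝ e y generalizing e
  · exact this h.neg (by simpa using (not_le.mp he).le)
  have hadd : ∀ s (y : E), inner ℝ m (y + s • m) = inner ℝ m y + s * ‖m‖ ^ 2 := fun s y => by
    rw [inner_add_right, real_inner_smul_right, real_inner_self_eq_norm_sq]
  have hside : ∀ s (y : E), inner ℝ m (y + s • (m - e)) = inner ℝ m y + s * ‖m‖ ^ 2 :=
    fun s y => by rw [smul_sub, ← add_sub_assoc, inner_sub_right, hadd, real_inner_smul_right,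
      h.orthogonal, mul_zero, sub_zero]
  rcases le_or_gt (t * ‖e‖ ^ 2) (inner ℝ e y) with hte | hte
  · rw [h.flow_eq_side hS ht hm hte, hside]
  have he_pos : 0 < ‖e‖ ^ 2 := pos_of_mul_pos_right (he.trans_lt hte) ht
  -- the orbit reaches the hyperplane `⟪e, ·⟫ = 0` at time `τ` and then follows `m`
  set τ := inner ℝ e y / ‖e‖ ^ 2
  have hτ : 0 ≤ τ := by positivity
  have hτe : τ * ‖e‖ ^ 2 = inner ℝ e y := div_mul_cancel₀ _ he_pos.ne'
  have hτt : 0 ≤ t - τ := sub_nonneg.mpr ((div_le_iff₀ he_pos).mpr hte.le)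
  have hmid : inner ℝ e (y + τ • (m - e)) = 0 := by
    rw [inner_add_right, real_inner_smul_right, inner_sub_right, h.orthogonal',
      real_inner_self_eq_norm_sq]
    linarith
  rw [← add_sub_cancel τ t, hS.map_add hτ hτt, h.flow_eq_side hS hτ hm hτe.le,
    h.flow_eq_mid hS hτt (by rw [hside]; positivity) hmid, hadd, hside]
  ring

theorem inner_eq_zero_of_flow_eq (h : IsDriftFrame f m e) (hS : IsGradientFlow f S)
    (ht : 0 < t) (hy : S t y = t • m) : inner ℝ m y = 0 := by
  have hm : 0 < ‖m‖ ^ 2 := by have := norm_pos_iff.mpr h.ne_zero; positivity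
  have hmt : inner ℝ m (S t y) = t * ‖m‖ ^ 2 := by
    rw [hy, real_inner_smul_right, real_inner_self_eq_norm_sq]
  have hle := h.le_inner_flow hS ht.le y
  by_contra hne
  have hneg : inner ℝ m y < 0 := lt_of_le_of_ne (by linarith) hne
  have hcont : ContinuousOn (fun s => (inner ℝ m (S s y) : ℝ)) (Icc 0 t) :=
    continuousOn_const.inner ((hS.continuousOn_time y).mono Icc_subset_Ici_self)
  obtain ⟨s, hs, hs0 : inner ℝ m (S s y) = 0⟩ :=
    intermediate_value_Icc ht.le hcont (show (0 : ℝ) ∈ Icc _ _ by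
      rw [hS.map_zero, hmt]
      exact ⟨hneg.le, by positivity⟩)
  have hlate := h.inner_flow hS (sub_nonneg.mpr hs.2) hs0.ge
  rw [← hS.map_add hs.1 (sub_nonneg.mpr hs.2), add_sub_cancel, hmt, hs0] at hlate
  have hs_zero : s = 0 := by nlinarith
  rw [hs_zero, hS.map_zero] at hs0
  exact hne hs0

end IsDriftFrame

variable [FiniteDimensional ℝ E] [MeasurableSpace E] [BorelSpace E] (μ : Measure E)
  [μ.IsAddHaarMeasure] {f : E → ℝ} {S : ℝ → E → E}

open Pointwise in
theorem IsGradientFlow.measure_fiber_smul_pos (hS : IsGradientFlow f S)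
    (hf : ∀ a : ℝ, 0 < a → ∀ x, f (a • x) = a * f x) {s t : ℝ} (hs : 0 < s) (ht : 0 ≤ t) {x : E}
    (hx : 0 < μ (S s ⁻¹' {x})) : 0 < μ (S s ⁻¹' {(s / (s + t)) • S t x}) := by
  have ha : 0 < s / (s + t) := by positivity
  have hsub : (s / (s + t)) • (S s ⁻¹' {x}) ⊆ S s ⁻¹' {(s / (s + t)) • S t x} := by
    rintro _ ⟨y, rfl, rfl⟩
    have hscale := hS.map_smul hf ha (t := s + t) (by positivity) y
    rwa [div_mul_cancel₀ _ (by positivity), hS.map_add hs.le ht] at hscale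
  refine lt_of_lt_of_le ?_ (measure_mono hsub)
  rw [Measure.addHaar_smul]
  exact ENNReal.mul_pos (ENNReal.ofReal_pos.mpr (by positivity)).ne' hx.ne'

/-- By `measure_fiber_smul_pos`, the rescaled orbit of `x` stays in the set of points whose fibre
at time `s` has positive measure. That set is countable, so the rescaled orbit is constant. -/
theorem IsGradientFlow.eq_smul_of_measure_fiber_pos (hS : IsGradientFlow f S)
    (hf : ∀ a : ℝ, 0 < a → ∀ x, f (a • x) = a * f x) {s t : ℝ} (hs : 0 < s) (ht : 0 ≤ t) {x : E}
    (hx : 0 < μ (S s ⁻¹' {x})) : S t x = ((s + t) / s) • x := by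
  have hcount : {z : E | 0 < μ (S s ⁻¹' {z})}.Countable :=
    Measure.countable_meas_pos_of_disjoint_iUnion
      (fun z => (hS.continuous hs.le).measurable (measurableSet_singleton z))
      fun z z' hne => (disjoint_singleton.mpr hne).preimage _
  set g : ℝ → E := fun t => (s / (s + t)) • S t x with hg
  have hcont : ContinuousOn g (Ici 0) := by
    refine ContinuousOn.smul (continuousOn_const.div (by fun_prop) fun t ht => ?_)
      (hS.continuousOn_time x)
    have : (0 : ℝ) ≤ t := ht
    positivity
  have hpos : g '' Ici 0 ⊆ {z : E | 0 < μ (S s ⁻¹' {z})} := by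
    rintro _ ⟨t, ht, rfl⟩
    exact hS.measure_fiber_smul_pos μ hf hs ht hx
  have hconst : g t = g 0 := hcount.isTotallyDisconnected _ hpos
    (isPreconnected_Ici.image g hcont) ⟨t, ht, rfl⟩ ⟨0, by simp, rfl⟩
  simp only [hg, add_zero, div_self hs.ne', one_smul, hS.map_zero] at hconst
  nth_rewrite 2 [← hconst]
  rw [smul_smul, div_mul_div_cancel₀ hs.ne', div_self (by positivity), one_smul]

theorem IsDriftFrame.measure_flow_fiber_eq_zero {m e : E} (h : IsDriftFrame f m e)
    (hS : IsGradientFlow f S) (hf : ∀ a : ℝ, 0 < a → ∀ x, f (a • x) = a * f x) {s : ℝ}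
    (hs : 0 < s) (x : E) : μ (S s ⁻¹' {x}) = 0 := by
  by_contra hne
  have hx : s⁻¹ • x - m = 0 := by
    refine eq_zero_of_norm_add_smul_le (x := x) (C := ‖x‖) fun t ht => ?_
    have hdist := hS.norm_sub_le ht x 0
    have hzero : S t 0 = t • m := by simpa using h.flow_smul hS le_rfl ht
    rw [hS.eq_smul_of_measure_fiber_pos μ hf hs ht (pos_iff_ne_zero.mpr hne), hzero, sub_zero,
      add_div, div_self hs.ne', div_eq_mul_inv] at hdist
    convert hdist using 2
    module
  have hxm : x = s • m := by rw [← sub_eq_zero.mp hx, smul_inv_smul₀ hs.ne']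
  have hker : S s ⁻¹' {x} ⊆ (LinearMap.ker (innerₛₗ ℝ m) : Set E) := by
    rintro y rfl
    exact h.inner_eq_zero_of_flow_eq hS hs hxm
  have htop : LinearMap.ker (innerₛₗ ℝ m) ≠ ⊤ := fun htop =>
    h.ne_zero (inner_self_eq_zero.mp (LinearMap.mem_ker.mp (htop ▸ Submodule.mem_top)))
  exact hne (measure_mono_null hker (Measure.addHaar_submodule μ _ htop))

end Drift

section MinInner

variable {E ι : Type*} [NormedAddCommGroup E] [InnerProductSpace ℝ E] [Fintype ι] [Nonempty ι]
  {b : ι → E}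

/-- The minimum of the linear functions with gradients `b i`, the generalization of `threeSector`
to any finite family of vectors. -/
def minInner (b : ι → E) (x : E) : ℝ :=
  Finset.univ.inf' Finset.univ_nonempty fun i => inner ℝ (b i) x

theorem minInner_le (x : E) (i : ι) : minInner b x ≤ inner ℝ (b i) x :=
  Finset.inf'_le _ (Finset.mem_univ i)

theorem le_minInner_iff {x : E} {a : ℝ} : a ≤ minInner b x ↔ ∀ i, a ≤ inner ℝ (b i) x := by
  simp [minInner]

theorem exists_inner_eq_minInner (b : ι → E) (x : E) : ∃ i, inner ℝ (b i) x = minInner b x := by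
  obtain ⟨i, -, hi⟩ := Finset.exists_mem_eq_inf' (Finset.univ_nonempty (α := ι))
    fun i => (inner ℝ (b i) x : ℝ)
  exact ⟨i, hi.symm⟩

theorem minInner_smul {a : ℝ} (ha : 0 ≤ a) (x : E) : minInner b (a • x) = a * minInner b x := by
  apply le_antisymm
  · obtain ⟨i, hi⟩ := exists_inner_eq_minInner b x
    rw [← hi, ← real_inner_smul_right]
    exact minInner_le _ i
  · refine le_minInner_iff.mpr fun i => ?_
    rw [real_inner_smul_right]
    exact mul_le_mul_of_nonneg_left (minInner_le x i) ha

theorem minInner_smul_left {a : ℝ} (ha : 0 ≤ a) (x : E) :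
    minInner (fun i => a • b i) x = a * minInner b x := by
  rw [← minInner_smul ha]
  simp only [minInner, real_inner_smul_left, real_inner_smul_right]

theorem minInner_sub (b : ι → E) (q x : E) :
    minInner (fun i => b i - q) x = minInner b x - inner ℝ q x := by
  apply le_antisymm
  · obtain ⟨i, hi⟩ := exists_inner_eq_minInner b x
    simpa only [← hi, ← inner_sub_left] using minInner_le (b := fun i => b i - q) x i
  · refine le_minInner_iff.mpr fun i => ?_
    rw [inner_sub_left]
    gcongr
    exact minInner_le x i

theorem exists_lipschitzWith_minInner (b : ι → E) : ∃ K, LipschitzWith K (minInner b) := by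
  refine ⟨∑ i, ‖b i‖₊, LipschitzWith.of_le_add_mul _ fun x y => ?_⟩
  obtain ⟨i, hi⟩ := exists_inner_eq_minInner b y
  calc minInner b x ≤ inner ℝ (b i) y + inner ℝ (b i) (x - y) := by
        rw [← inner_add_right, add_sub_cancel]
        exact minInner_le x i
    _ ≤ minInner b y + ‖b i‖ * ‖x - y‖ := by rw [hi]; gcongr; exact real_inner_le_norm _ _
    _ ≤ _ := by
        rw [dist_eq_norm, NNReal.coe_sum]
        gcongr
        exact Finset.single_le_sum (f := fun i => ‖b i‖) (fun _ _ => norm_nonneg _)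
          (Finset.mem_univ i)

theorem continuous_minInner (b : ι → E) : Continuous (minInner b) :=
  (exists_lipschitzWith_minInner b).choose_spec.continuous

theorem concaveOn_minInner (b : ι → E) : ConcaveOn ℝ univ (minInner b) := by
  refine ⟨convex_univ, fun x _ y _ α β hα hβ _ => le_minInner_iff.mpr fun i => ?_⟩
  rw [inner_add_right, real_inner_smul_right, real_inner_smul_right]
  exact add_le_add (mul_le_mul_of_nonneg_left (minInner_le x i) hα)
    (mul_le_mul_of_nonneg_left (minInner_le y i) hβ)

theorem minInner_le_inner {p : E} (hp : p ∈ convexHull ℝ (range b)) (x : E) :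
    minInner b x ≤ inner ℝ p x :=
  convexHull_min (t := {p | minInner b x ≤ inner ℝ p x}) (range_subset_iff.mpr (minInner_le x))
    (convex_halfSpace_ge ((innerₛₗ ℝ).flip x).isLinear _) hp

theorem isSupergradient_minInner {x p : E}
    (hp : p ∈ convexHull ℝ (b '' {i | inner ℝ (b i) x = minInner b x})) :
    IsSupergradient (minInner b) 0 x p :=
  isSupergradient_of_le_inner (minInner_le_inner (convexHull_mono (image_subset_range _ _) hp))
    (convexHull_min (t := {p | inner ℝ p x ≤ minInner b x}) (by rintro _ ⟨i, hi, rfl⟩; exact hi.le)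
      (convex_halfSpace_le ((innerₛₗ ℝ).flip x).isLinear _) hp)

theorem eventually_minInner_add_smul {x p : E}
    (hp : ∀ i, inner ℝ (b i) x = minInner b x → inner ℝ (b i) p = ‖p‖ ^ 2) :
    ∀ᶠ h in 𝓝 (0 : ℝ), minInner b (x + h • p) = minInner b x + h * ‖p‖ ^ 2 := by
  have hle : ∀ i, ∀ᶠ h in 𝓝 (0 : ℝ),
      minInner b x + h * ‖p‖ ^ 2 ≤ inner ℝ (b i) (x + h • p) := by
    intro i
    rcases (minInner_le (b := b) x i).eq_or_lt with hi | hi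
    · refine Eventually.of_forall fun h => ?_
      rw [inner_add_right, real_inner_smul_right, hp i hi.symm, hi]
    · refine Eventually.mono ?_ fun _ => le_of_lt
      refine (Continuous.tendsto (by fun_prop) 0).eventually_lt
        (Continuous.tendsto (by fun_prop) 0) ?_
      simpa using hi
  filter_upwards [eventually_all.mpr hle] with h hle
  refine le_antisymm ?_ (le_minInner_iff.mpr hle)
  obtain ⟨i, hi⟩ := exists_inner_eq_minInner b x
  have := minInner_le (b := b) (x + h • p) i
  rwa [inner_add_right, real_inner_smul_right, hi, hp i hi] at this

/-- The increment `x - y` is the projection of `-y` onto the convex hull of the `t • b i`. -/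
theorem exists_isResolvent_minInner (b : ι → E) {t : ℝ} (ht : 0 ≤ t) (y : E) :
    ∃ x, IsResolvent (minInner b) t y x := by
  set K := convexHull ℝ (range fun i => t • b i)
  have hcomplete : IsComplete K := ((finite_range _).isCompact_convexHull ℝ).isComplete
  obtain ⟨v, hvK, hv⟩ := exists_norm_eq_iInf_of_complete_convex
    (range_nonempty _).convexHull hcomplete (convex_convexHull ℝ _) (-y)
  rw [norm_eq_iInf_iff_real_inner_le_zero (convex_convexHull ℝ _) hvK] at hv
  refine ⟨y + v, fun w => ?_⟩
  have hactive : inner ℝ v (y + v) ≤ t * minInner b (y + v) := by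
    rw [← minInner_smul_left ht]
    refine le_minInner_iff.mpr fun i => ?_
    have := hv _ (subset_convexHull ℝ _ (mem_range_self i))
    rw [inner_sub_right, ← neg_add', inner_neg_left, inner_neg_left, real_inner_comm,
      real_inner_comm v] at this
    linarith
  have hle : t * minInner b w ≤ inner ℝ v w := by
    rw [← minInner_smul_left ht]
    exact minInner_le_inner hvK w
  rw [add_sub_cancel_left, inner_sub_right]
  linarith

theorem isResolvent_minInner_zero {t : ℝ} (ht : 0 ≤ t) {p : E}
    (hp : p ∈ convexHull ℝ (range b)) : IsResolvent (minInner b) t (-t • p) 0 := fun w => by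
  have hzero : minInner b 0 = 0 := by simp [minInner]
  simpa [hzero, real_inner_smul_left] using mul_le_mul_of_nonneg_left (minInner_le_inner hp w) ht

end MinInner

section Midpoint

variable {E ι : Type*} [NormedAddCommGroup E] [InnerProductSpace ℝ E]

theorem inner_midpoint_of_norm_eq {x y : E} (h : ‖x‖ = ‖y‖) :
    inner ℝ x (midpoint ℝ x y) = ‖midpoint ℝ x y‖ ^ 2 := by
  rw [midpoint_eq_smul_add, norm_smul, mul_pow, norm_add_sq_real, real_inner_smul_right,
    inner_add_right, real_inner_self_eq_norm_sq, h]
  norm_num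
  ring

/-- The witness is the point of least norm of the face of active gradients: the origin when all
three are active, the midpoint of an edge or a vertex otherwise. -/
theorem exists_isSupergradient_eventually_eq {b : Fin 3 → E} {R : ℝ} (hR : ∀ i, ‖b i‖ = R)
    (h0 : 0 ∈ convexHull ℝ (range b)) (x : E) :
    ∃ p, IsSupergradient (minInner b) 0 x p ∧
      ∀ᶠ h in 𝓝 (0 : ℝ), minInner b (x + h • p) = minInner b x + h * ‖p‖ ^ 2 := by
  suffices ∃ p ∈ convexHull ℝ (b '' {i | inner ℝ (b i) x = minInner b x}),
      ∀ i, inner ℝ (b i) x = minInner b x → inner ℝ (b i) p = ‖p‖ ^ 2 by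
    obtain ⟨p, hp, hpi⟩ := this
    exact ⟨p, isSupergradient_minInner hp, eventually_minInner_add_smul hpi⟩
  by_cases hall : ∀ i, inner ℝ (b i) x = minInner b x
  · exact ⟨0, by simpa [hall] using h0, by simp⟩
  obtain ⟨i, j, hi, hj, hij⟩ : ∃ i j, inner ℝ (b i) x = minInner b x ∧
      inner ℝ (b j) x = minInner b x ∧
      ∀ l, inner ℝ (b l) x = minInner b x → l = i ∨ l = j := by
    push Not at hall
    obtain ⟨k, hk⟩ := hall
    obtain ⟨i, hi⟩ := exists_inner_eq_minInner b x
    by_cases hex : ∃ j, j ≠ i ∧ inner ℝ (b j) x = minInner b x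
    · obtain ⟨j, hji, hj⟩ := hex
      refine ⟨i, j, hi, hj, fun l hl => ?_⟩
      have hlk : l ≠ k := fun h => hk (h ▸ hl)
      have hik : i ≠ k := fun h => hk (h ▸ hi)
      have hjk : j ≠ k := fun h => hk (h ▸ hj)
      omega
    · exact ⟨i, i, hi, hi, fun l hl => by_contra fun hne => hex ⟨l, fun h => hne (.inl h), hl⟩⟩
  refine ⟨midpoint ℝ (b i) (b j), (convex_convexHull ℝ _).midpoint_mem
    (subset_convexHull ℝ _ (mem_image_of_mem b hi))
    (subset_convexHull ℝ _ (mem_image_of_mem b hj)), fun l hl => ?_⟩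
  rcases hij l hl with rfl | rfl
  · exact inner_midpoint_of_norm_eq (by rw [hR, hR])
  · rw [midpoint_comm]
    exact inner_midpoint_of_norm_eq (by rw [hR, hR])

theorem isDriftFrame_minInner [Fintype ι] [Nonempty ι] {b : ι → E} {m e : E} (hm : m ≠ 0)
    (hme : inner ℝ m e = 0) {i j : ι} (hi : b i = m + e) (hj : b j = m - e)
    (hb : ∀ l, ∃ α β : ℝ, 1 ≤ α ∧ |β| ≤ 1 ∧ b l = α • m + β • e) :
    IsDriftFrame (minInner b) m e where
  ne_zero := hm
  orthogonal := hme
  le w := by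
    have hwi := minInner_le (b := b) w i
    have hwj := minInner_le (b := b) w j
    rw [hi, inner_add_left] at hwi
    rw [hj, inner_sub_left] at hwj
    rcases abs_cases (inner ℝ e w) with h | h <;> linarith
  ge w hw := by
    refine le_minInner_iff.mpr fun l => ?_
    obtain ⟨α, β, hα, hβ, hl⟩ := hb l
    rw [hl, inner_add_left, real_inner_smul_left, real_inner_smul_left]
    have hmul : -|inner ℝ e w| ≤ β * inner ℝ e w := neg_le.mp <| (neg_le_abs _).trans <| by
      rw [abs_mul]
      exact mul_le_of_le_one_left (abs_nonneg _) hβ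
    linarith [le_mul_of_one_le_left hw hα]

theorem abs_le_one_of_norm_add_smul_le {m e : E} {α β : ℝ} (hme : inner ℝ m e = 0) (he : e ≠ 0)
    (hα : 1 ≤ α) (h : ‖α • m + β • e‖ ≤ ‖m + e‖) : |β| ≤ 1 := by
  have he_pos : 0 < ‖e‖ ^ 2 := by have := norm_pos_iff.mpr he; positivity
  have hsq : ‖α • m + β • e‖ ^ 2 ≤ ‖m + e‖ ^ 2 := by gcongr
  rw [norm_add_sq_real, norm_add_sq_real, real_inner_smul_left, real_inner_smul_right, hme,
    norm_smul, norm_smul, mul_pow, mul_pow, Real.norm_eq_abs, Real.norm_eq_abs, sq_abs,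
    sq_abs] at hsq
  have hβ : β ^ 2 * ‖e‖ ^ 2 ≤ 1 * ‖e‖ ^ 2 := by
    linarith [le_mul_of_one_le_left (sq_nonneg ‖m‖) (one_le_pow₀ hα (n := 2))]
  exact (sq_le_one_iff_abs_le_one β).mp (le_of_mul_le_mul_right hβ he_pos)

theorem exists_weight_neg_of_notMem_convexHull [Fintype ι] {b : ι → E} {x : E}
    (hx : x ∈ affineSpan ℝ (range b)) (hx' : x ∉ convexHull ℝ (range b)) :
    ∃ c : ι → ℝ, ∑ i, c i = 1 ∧ ∑ i, c i • b i = x ∧ ∃ k, c k < 0 := by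
  obtain ⟨c, hc, rfl⟩ := eq_affineCombination_of_mem_affineSpan_of_fintype hx
  rw [Finset.affineCombination_eq_linear_combination _ _ _ hc] at hx' ⊢
  refine ⟨c, hc, rfl, ?_⟩
  by_contra! hnonneg
  exact hx' ((convex_convexHull ℝ _).sum_mem (fun i _ => hnonneg i) hc fun i _ =>
    subset_convexHull ℝ _ (mem_range_self i))

/-- The ray through `m`, the midpoint of the edge opposite to the vertex of negative weight, is a
face of the partition of space into sectors. -/
theorem exists_isDriftFrame {b : Fin 3 → E} {R : ℝ} (hR : ∀ i, ‖b i‖ = R)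
    (hinj : Function.Injective b) (hspan : 0 ∈ affineSpan ℝ (range b))
    (h0 : 0 ∉ convexHull ℝ (range b)) : ∃ m e, IsDriftFrame (minInner b) m e := by
  obtain ⟨c, hc1, hc0, k, hk⟩ := exists_weight_neg_of_notMem_convexHull hspan h0
  obtain ⟨i, j, hik, hjk, hij, huniv⟩ : ∃ i j : Fin 3, i ≠ k ∧ j ≠ k ∧ i ≠ j ∧
      (Finset.univ : Finset (Fin 3)) = {i, j, k} := by
    refine ⟨k + 1, k + 2, ?_⟩
    fin_cases k <;> decide
  rw [huniv, Finset.sum_insert (by simp [hij, hik]), Finset.sum_pair hjk] at hc1 hc0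
  set m := midpoint ℝ (b i) (b j) with hm
  obtain ⟨e, hbi, hbj⟩ : ∃ e, b i = m + e ∧ b j = m - e :=
    ⟨b i - m, by abel, by rw [hm, midpoint_eq_smul_add, invOf_eq_inv]; module⟩
  have hme : inner ℝ m e = 0 := by
    have := inner_midpoint_of_norm_eq ((hR i).trans (hR j).symm)
    rw [← hm, real_inner_comm, hbi, inner_add_right, real_inner_self_eq_norm_sq] at this
    linarith
  have hm0 : m ≠ 0 := fun hm0 => h0 <| hm0 ▸ (convex_convexHull ℝ _).midpoint_mem
    (subset_convexHull ℝ _ (mem_range_self i)) (subset_convexHull ℝ _ (mem_range_self j))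
  have he0 : e ≠ 0 := fun he0 => hij (hinj (by rw [hbi, hbj, he0, add_zero, sub_zero]))
  clear_value m
  have hbk : b k = (1 + (-c k)⁻¹) • m + ((c i - c j) / -c k) • e := by
    have hck : -c k ≠ 0 := by linarith
    have hscaled : (-c k) • b k = (1 + -c k) • m + (c i - c j) • e := by
      have hcombine : (-c k) • b k =
          c i • (m + e) + c j • (m - e) - (c i • b i + (c j • b j + c k • b k)) := by
        rw [hbi, hbj]
        module
      rw [hcombine, hc0, show 1 + -c k = c i + c j by linarith]
      module
    rw [← inv_smul_smul₀ hck (b k), hscaled, smul_add, smul_smul, smul_smul, mul_add, mul_one,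
      inv_mul_cancel₀ hck, add_comm _ (1 : ℝ), div_eq_inv_mul]
  have hα : 1 ≤ 1 + (-c k)⁻¹ := by
    have : 0 < -c k := by linarith
    linarith [inv_pos.mpr this]
  refine ⟨m, e, isDriftFrame_minInner hm0 hme hbi hbj fun l => ?_⟩
  have hl : l ∈ ({i, j, k} : Finset (Fin 3)) := huniv ▸ Finset.mem_univ l
  rcases (by simpa using hl) with rfl | rfl | rfl
  · exact ⟨1, 1, by simp, by simp, by rw [hbi]; module⟩
  · exact ⟨1, -1, by simp, by simp, by rw [hbj]; module⟩
  · exact ⟨_, _, hα, abs_le_one_of_norm_add_smul_le hme he0 hα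
      (by rw [← hbk, ← hbi, hR, hR]), hbk⟩

end Midpoint

theorem threeSector_eq_minInner (v : Fin 3 → EuclideanSpace ℝ (Fin 2)) :
    threeSector v = minInner v := rfl

section Translation

open scoped Pointwise

theorem range_sub_const {E ι : Type*} [AddCommGroup E] (v : ι → E) (q : E) :
    (range fun i => v i - q) = -q +ᵥ range v := by
  rw [vadd_set_range]
  simp only [vadd_eq_add, sub_eq_neg_add]

variable {E ι : Type*} [AddCommGroup E] [Module ℝ E] {v : ι → E} {q x : E}

theorem mem_convexHull_range_sub_iff :
    x ∈ convexHull ℝ (range fun i => v i - q) ↔ x + q ∈ convexHull ℝ (range v) := by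
  rw [range_sub_const, convexHull_vadd, mem_vadd_set_iff_neg_vadd_mem, neg_neg, vadd_eq_add,
    add_comm]

theorem mem_affineSpan_range_sub_iff :
    x ∈ affineSpan ℝ (range fun i => v i - q) ↔ x + q ∈ affineSpan ℝ (range v) := by
  rw [range_sub_const, ← AffineSubspace.pointwise_vadd_span,
    ← AffineSubspace.vadd_mem_pointwise_vadd_iff (v := q), vadd_vadd, add_neg_cancel, zero_vadd,
    vadd_eq_add, add_comm]

end Translation

section LogConvexity

/-- The densities `exp (F x a - log ∫ exp (F x))` have integral one, so the convexity of `exp`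
bounds the integral of their geometric mean by one. -/
theorem convexOn_log_integral_exp {α V : Type*} [MeasurableSpace α] {μ : Measure α} [NeZero μ]
    [AddCommGroup V] [Module ℝ V] {s : Set V} {F : V → α → ℝ} (hs : Convex ℝ s)
    (hF : ∀ a, ConvexOn ℝ s fun x => F x a)
    (hint : ∀ x ∈ s, Integrable (fun a => Real.exp (F x a)) μ) :
    ConvexOn ℝ s fun x => Real.log (∫ a, Real.exp (F x a) ∂μ) := by
  refine ⟨hs, fun x hx y hy α β hα hβ hαβ => ?_⟩
  set Λ : V → ℝ := fun x => Real.log (∫ a, Real.exp (F x a) ∂μ)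
  have hnormalized : ∀ z ∈ s, Integrable (fun a => Real.exp (F z a - Λ z)) μ ∧
      ∫ a, Real.exp (F z a - Λ z) ∂μ = 1 := by
    intro z hz
    have hpos := integral_exp_pos (hint z hz)
    simp only [Real.exp_sub, Λ, Real.exp_log hpos, integral_div, div_self hpos.ne', and_true]
    exact (hint z hz).div_const _
  have hxy := hs hx hy hα hβ hαβ
  set A := α • Λ x + β • Λ y
  have hle : ∫ a, Real.exp (F (α • x + β • y) a - A) ∂μ ≤
      ∫ a, α * Real.exp (F x a - Λ x) + β * Real.exp (F y a - Λ y) ∂μ := by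
    refine integral_mono ?_ (((hnormalized x hx).1.const_mul α).add
      ((hnormalized y hy).1.const_mul β)) fun a => ?_
    · simpa only [Real.exp_sub] using (hint _ hxy).div_const _
    · calc Real.exp (F (α • x + β • y) a - A)
          ≤ Real.exp (α • (F x a - Λ x) + β • (F y a - Λ y)) := by
            have := (hF a).2 hx hy hα hβ hαβ
            simp only [A, smul_eq_mul] at this ⊢
            gcongr
            linarith
        _ ≤ _ := convexOn_exp.2 (mem_univ _) (mem_univ _) hα hβ hαβ
  rw [integral_add ((hnormalized x hx).1.const_mul α) ((hnormalized y hy).1.const_mul β),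
    integral_const_mul, integral_const_mul, (hnormalized x hx).2, (hnormalized y hy).2] at hle
  simp only [Real.exp_sub, integral_div] at hle
  rw [div_le_iff₀ (Real.exp_pos A), mul_one, mul_one, hαβ, one_mul] at hle
  exact (Real.log_le_iff_le_exp (integral_exp_pos (hint _ hxy))).mpr hle

theorem isSupergradient_of_hasGradientAt {E : Type*} [NormedAddCommGroup E]
    [InnerProductSpace ℝ E] [CompleteSpace E] {f : E → ℝ} {x p : E} (hf : ConcaveOn ℝ univ f)
    (h : HasGradientAt f p x) : IsSupergradient f 0 x p := by
  intro w
  have hline : ConcaveOn ℝ univ (f ∘ AffineMap.lineMap (k := ℝ) x w) := hf.comp_affineMap _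
  have hderiv : HasDerivAt (f ∘ AffineMap.lineMap (k := ℝ) x w) (inner ℝ p (w - x)) 0 := by
    have h' : HasFDerivAt f (InnerProductSpace.toDual ℝ E p)
        (AffineMap.lineMap x w (0 : ℝ)) := by simpa using h.hasFDerivAt
    simpa using h'.comp_hasDerivAt (0 : ℝ) AffineMap.hasDerivAt_lineMap
  have := hline.slope_le_of_hasDerivAt (mem_univ 0) (mem_univ 1) one_pos hderiv
  simp only [slope_def_field, Function.comp_apply, AffineMap.lineMap_apply_zero,
    AffineMap.lineMap_apply_one, sub_zero, div_one] at this
  linarith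

end LogConvexity

section Laplace

variable {E : Type*} [NormedAddCommGroup E] [InnerProductSpace ℝ E] [FiniteDimensional ℝ E]
  [MeasurableSpace E] [BorelSpace E]

theorem integrable_mul_exp_mul_norm_smul {μ : Measure E} {w : E → ℝ}
    (hw : ∀ a, Integrable (fun z => w z * Real.exp (a * ‖z‖)) μ) (a : ℝ) :
    Integrable (fun z => (w z * Real.exp (a * ‖z‖)) • z) μ := by
  refine (hw (a + 1)).mono ((hw a).1.smul aestronglyMeasurable_id) (ae_of_all _ fun z => ?_)
  rw [norm_smul, norm_mul, norm_mul, Real.norm_of_nonneg (Real.exp_pos _).le,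
    Real.norm_of_nonneg (Real.exp_pos _).le, add_mul, one_mul, Real.exp_add, ← mul_assoc]
  gcongr
  linarith [Real.add_one_le_exp ‖z‖]

theorem hasGradientAt_integral_mul_exp_inner {μ : Measure E} {w : E → ℝ}
    (hw : ∀ a, Integrable (fun z => w z * Real.exp (a * ‖z‖)) μ) :
    HasGradientAt (fun ξ => ∫ z, w z * Real.exp (inner ℝ ξ z) ∂μ) (∫ z, w z • z ∂μ) 0 := by
  have hw0 : Integrable w μ := by simpa using hw 0
  have hwz : Integrable (fun z => w z • z) μ := by
    simpa using integrable_mul_exp_mul_norm_smul hw 0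
  have hmeas : ∀ ξ : E, AEStronglyMeasurable (fun z => w z * Real.exp (inner ℝ ξ z)) μ :=
    fun ξ => hw0.1.mul (by fun_prop)
  have key := hasFDerivAt_integral_of_dominated_of_fderiv_le (𝕜 := ℝ) (μ := μ) (x₀ := (0 : E))
    (F := fun ξ z => w z * Real.exp (inner ℝ ξ z))
    (F' := fun ξ z => (w z * Real.exp (inner ℝ ξ z)) • innerSL ℝ z)
    (bound := fun z => ‖(w z * Real.exp (1 * ‖z‖)) • z‖) (Metric.ball_mem_nhds 0 one_pos)
    (Eventually.of_forall hmeas) (by simpa using hw0)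
    ((hmeas 0).smul (innerSL ℝ).continuous.aestronglyMeasurable)
    (ae_of_all _ fun z ξ hξ => ?_) (integrable_mul_exp_mul_norm_smul hw 1).norm
    (ae_of_all _ fun z ξ _ => ?_)
  · rw [hasGradientAt_iff_hasFDerivAt]
    refine key.congr_fderiv (ContinuousLinearMap.ext fun p => ?_)
    rw [InnerProductSpace.toDual_apply_apply, real_inner_comm, ← integral_inner hwz,
      ContinuousLinearMap.integral_apply]
    · simp [real_inner_smul_right, real_inner_comm]
    · simpa using (innerSL ℝ).integrable_comp hwz
  · have hinner : inner ℝ ξ z ≤ 1 * ‖z‖ := (real_inner_le_norm ξ z).trans (by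
      gcongr
      exact (mem_ball_zero_iff.mp hξ).le)
    rw [norm_smul, norm_smul, innerSL_apply_norm, norm_mul, norm_mul,
      Real.norm_of_nonneg (Real.exp_pos _).le, Real.norm_of_nonneg (Real.exp_pos _).le]
    gcongr
  · have hinner : HasFDerivAt (fun ξ : E => (inner ℝ ξ z : ℝ)) (innerSL ℝ z) ξ := by
      simp only [real_inner_comm z]
      exact (innerSL ℝ z).hasFDerivAt
    simpa only [smul_smul] using hinner.exp.const_mul (w z)

end Laplace

section Gaussian

variable {E : Type*} [NormedAddCommGroup E] [InnerProductSpace ℝ E] [FiniteDimensional ℝ E]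
  [MeasurableSpace E] [BorelSpace E]

theorem integral_exp_neg_norm_sq_div_two :
    ∫ z : E, Real.exp (-‖z‖ ^ 2 / 2) = (2 * Real.pi) ^ (Module.finrank ℝ E / 2 : ℝ) := by
  have h := GaussianFourier.integral_rexp_neg_mul_sq_norm (V := E) (b := 1 / 2) one_half_pos
  rw [show Real.pi / (1 / 2) = 2 * Real.pi by ring] at h
  simpa only [neg_div, neg_mul, one_div_mul_eq_div] using h

theorem integrable_exp_neg_norm_sq_add_mul_norm (a : ℝ) :
    Integrable (fun z : E => Real.exp (-‖z‖ ^ 2 / 2 + a * ‖z‖)) := by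
  have hgaussian : Integrable fun z : E => Real.exp (-(1 / 4) * ‖z‖ ^ 2) := by
    have := (GaussianFourier.integrable_cexp_neg_mul_sq_norm_add (V := E) (b := 1 / 4)
      (by norm_num) 0 0).norm
    refine this.congr (ae_of_all _ fun z => ?_)
    simp [Complex.norm_exp, ← Complex.ofReal_pow]
  refine (hgaussian.const_mul (Real.exp (a ^ 2))).mono' (by fun_prop) (ae_of_all _ fun z => ?_)
  rw [Real.norm_of_nonneg (Real.exp_pos _).le, ← Real.exp_add]
  refine Real.exp_le_exp.mpr ?_
  linarith [sq_nonneg (a - ‖z‖ / 2)]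

end Gaussian

section GibbsWeight

variable {E : Type*} [NormedAddCommGroup E] [InnerProductSpace ℝ E] {ψ : E → ℝ} {K : NNReal}
  {s ρ : ℝ}

/-- The Gibbs weight of the Cole-Hopf formula in the coordinate `z = (y - x) / s`. With `ψ = φ / ε`
and `s = √(ε t)` its integral is, up to a constant, the heat integral of `viscousPotential`. -/
def gibbsWeight (ψ : E → ℝ) (s : ℝ) (x z : E) : ℝ :=
  Real.exp (-‖z‖ ^ 2 / 2 - ψ (x + s • z))

theorem gibbsWeight_pos (x z : E) : 0 < gibbsWeight ψ s x z := Real.exp_pos _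

theorem norm_gibbsWeight (x z : E) : ‖gibbsWeight ψ s x z‖ = gibbsWeight ψ s x z :=
  Real.norm_of_nonneg (gibbsWeight_pos x z).le

theorem continuous_gibbsWeight (hψ : Continuous ψ) (s : ℝ) (x : E) :
    Continuous (gibbsWeight ψ s x) := by
  unfold gibbsWeight
  fun_prop

theorem abs_comp_add_smul_sub_le (hψ : LipschitzWith K ψ) (hs : s ∈ Icc 0 ρ) (x z : E) :
    |ψ (x + s • z) - ψ x| ≤ K * ρ * ‖z‖ := by
  have h := hψ.dist_le_mul (x + s • z) x
  rw [Real.dist_eq, dist_self_add_left, norm_smul, Real.norm_of_nonneg hs.1, ← mul_assoc] at h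
  refine h.trans ?_
  gcongr
  exact hs.2

theorem gibbsWeight_le (hψ : LipschitzWith K ψ) (hs : s ∈ Icc 0 ρ) (x z : E) :
    gibbsWeight ψ s x z ≤ Real.exp (-ψ x) * Real.exp (-‖z‖ ^ 2 / 2 + K * ρ * ‖z‖) := by
  rw [gibbsWeight, ← Real.exp_add, Real.exp_le_exp]
  linarith [(abs_le.mp (abs_comp_add_smul_sub_le hψ hs x z)).1]

theorem le_gibbsWeight (hψ : LipschitzWith K ψ) (hs : s ∈ Icc 0 ρ) (x z : E) :
    Real.exp (-ψ x) * Real.exp (-‖z‖ ^ 2 / 2 + -(K * ρ) * ‖z‖) ≤ gibbsWeight ψ s x z := by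
  rw [gibbsWeight, ← Real.exp_add, Real.exp_le_exp]
  linarith [(abs_le.mp (abs_comp_add_smul_sub_le hψ hs x z)).2]

theorem abs_gibbsWeight_sub_le (hψ : LipschitzWith K ψ) (x y z : E) :
    |gibbsWeight ψ s x z - gibbsWeight ψ s y z| ≤
      (Real.exp (K * ‖x - y‖) - 1) * gibbsWeight ψ s y z := by
  set θ := K * ‖x - y‖
  have hθ : |ψ (x + s • z) - ψ (y + s • z)| ≤ θ := by
    simpa [Real.dist_eq, dist_eq_norm] using hψ.dist_le_mul (x + s • z) (y + s • z)
  obtain ⟨hlow, hup⟩ := abs_le.mp hθ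
  have hratio : gibbsWeight ψ s x z =
      Real.exp (-(ψ (x + s • z) - ψ (y + s • z))) * gibbsWeight ψ s y z := by
    rw [gibbsWeight, gibbsWeight, ← Real.exp_add]
    ring_nf
  have hexp : |Real.exp (-(ψ (x + s • z) - ψ (y + s • z))) - 1| ≤ Real.exp θ - 1 := by
    rw [abs_le]
    constructor
    · linarith [Real.exp_le_exp.mpr (neg_le_neg hup), Real.add_one_le_exp θ,
        Real.add_one_le_exp (-θ)]
    · linarith [Real.exp_le_exp.mpr (neg_le.mpr hlow)]
  rw [hratio, ← sub_one_mul, abs_mul, abs_of_pos (gibbsWeight_pos y z)]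
  exact mul_le_mul_of_nonneg_right hexp (gibbsWeight_pos y z).le

variable [FiniteDimensional ℝ E] [MeasurableSpace E] [BorelSpace E]

theorem integrable_gibbsWeight_mul_exp (hψ : LipschitzWith K ψ) (hs : 0 ≤ s) (x : E) (a : ℝ) :
    Integrable fun z => gibbsWeight ψ s x z * Real.exp (a * ‖z‖) := by
  have hcont := continuous_gibbsWeight hψ.continuous s x
  refine ((integrable_exp_neg_norm_sq_add_mul_norm (K * s + a)).const_mul (Real.exp (-ψ x))).mono'
    (by fun_prop) (ae_of_all _ fun z => ?_)
  rw [norm_mul, norm_gibbsWeight, Real.norm_of_nonneg (Real.exp_pos _).le, add_mul, ← add_assoc,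
    Real.exp_add _ (a * ‖z‖), ← mul_assoc]
  exact mul_le_mul_of_nonneg_right (gibbsWeight_le hψ ⟨hs, le_rfl⟩ x z) (Real.exp_pos _).le

theorem integrable_gibbsWeight (hψ : LipschitzWith K ψ) (hs : 0 ≤ s) (x : E) :
    Integrable (gibbsWeight ψ s x) := by
  simpa using integrable_gibbsWeight_mul_exp hψ hs x 0

theorem integrable_gibbsWeight_smul (hψ : LipschitzWith K ψ) (hs : 0 ≤ s) (x : E) :
    Integrable fun z => gibbsWeight ψ s x z • z := by
  simpa using integrable_mul_exp_mul_norm_smul (integrable_gibbsWeight_mul_exp hψ hs x) 0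

theorem integral_gibbsWeight_pos (hψ : LipschitzWith K ψ) (hs : 0 ≤ s) (x : E) :
    0 < ∫ z, gibbsWeight ψ s x z :=
  integral_exp_pos (integrable_gibbsWeight hψ hs x)

theorem continuousOn_integral_gibbsWeight_smul {F : Type*} [NormedAddCommGroup F]
    [NormedSpace ℝ F] {g : E → F} (hψ : LipschitzWith K ψ) (hg : Continuous g)
    (hle : ∀ z, ‖g z‖ ≤ Real.exp ‖z‖) (ρ : ℝ) (x : E) :
    ContinuousOn (fun s => ∫ z, gibbsWeight ψ s x z • g z) (Icc 0 ρ) := by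
  have hcont := hψ.continuous
  refine continuousOn_of_dominated (bound := fun z => Real.exp (-ψ x) *
    Real.exp (-‖z‖ ^ 2 / 2 + (K * ρ + 1) * ‖z‖))
    (fun s _ => ((continuous_gibbsWeight hcont s x).smul hg).aestronglyMeasurable)
    (fun s hs => ae_of_all _ fun z => ?_)
    ((integrable_exp_neg_norm_sq_add_mul_norm _).const_mul _) (ae_of_all _ fun z => ?_)
  · rw [norm_smul, norm_gibbsWeight, add_mul, one_mul, ← add_assoc, Real.exp_add _ ‖z‖,
      ← mul_assoc]
    exact mul_le_mul (gibbsWeight_le hψ hs x z) (hle z) (norm_nonneg _) (by positivity)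
  · unfold gibbsWeight
    fun_prop

/-- Translating `z` moves the dependence on the centre from `ψ`, which is not differentiable, to
the Gaussian. -/
theorem integral_gibbsWeight_eq_mul_integral (hs : s ≠ 0) (x y : E) :
    ∫ z, gibbsWeight ψ s y z = Real.exp (-‖s⁻¹ • (y - x)‖ ^ 2 / 2) *
      ∫ z, gibbsWeight ψ s x z * Real.exp (inner ℝ (s⁻¹ • (y - x)) z) := by
  set ξ := s⁻¹ • (y - x) with hξ
  have hshift : ∀ z, y + s • (z - ξ) = x + s • z := by
    intro z
    rw [hξ, smul_sub, smul_inv_smul₀ hs]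
    abel
  rw [← integral_sub_right_eq_self _ ξ, ← integral_const_mul]
  refine integral_congr_ae (ae_of_all _ fun z => ?_)
  simp only [gibbsWeight, hshift, ← Real.exp_add]
  rw [norm_sub_sq_real, real_inner_comm z ξ]
  ring_nf

theorem hasGradientAt_integral_gibbsWeight (hψ : LipschitzWith K ψ) (hs : 0 < s) (x : E) :
    HasGradientAt (fun x => ∫ z, gibbsWeight ψ s x z) (s⁻¹ • ∫ z, gibbsWeight ψ s x z • z) x := by
  rw [funext (integral_gibbsWeight_eq_mul_integral hs.ne' x), hasGradientAt_iff_hasFDerivAt]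
  have hlaplace := (hasGradientAt_integral_mul_exp_inner
    (integrable_gibbsWeight_mul_exp hψ hs.le x)).hasFDerivAt
  have hgauss : HasFDerivAt (fun ξ : E => Real.exp (-‖ξ‖ ^ 2 / 2)) (0 : E →L[ℝ] ℝ) 0 := by
    have := ((hasFDerivAt_id (𝕜 := ℝ) (0 : E)).norm_sq.neg.mul_const (2⁻¹ : ℝ)).exp
    simpa [div_eq_mul_inv] using this
  have hscale : HasFDerivAt (fun y => s⁻¹ • (y - x)) (s⁻¹ • ContinuousLinearMap.id ℝ E) x :=
    ((hasFDerivAt_id x).sub_const x).const_smul s⁻¹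
  have hzero : s⁻¹ • (x - x) = 0 := by rw [sub_self, smul_zero]
  have key := (hzero ▸ hgauss.mul hlaplace).comp x hscale
  refine key.congr_fderiv (ContinuousLinearMap.ext fun p => ?_)
  simp

theorem convexOn_log_integral_gibbsWeight (hψ : LipschitzWith K ψ) (hconc : ConcaveOn ℝ univ ψ)
    (hs : 0 ≤ s) : ConvexOn ℝ univ fun x => Real.log (∫ z, gibbsWeight ψ s x z) := by
  refine convexOn_log_integral_exp convex_univ (fun z => ?_) fun x _ =>
    integrable_gibbsWeight hψ hs x
  have hshift : ConvexOn ℝ univ fun x => -ψ (x + s • z) := (hconc.translate_left (s • z)).neg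
  exact (convexOn_const (-‖z‖ ^ 2 / 2) convex_univ).add hshift

end GibbsWeight

section GibbsMean

variable {E : Type*} [NormedAddCommGroup E] [InnerProductSpace ℝ E] [FiniteDimensional ℝ E]
  [MeasurableSpace E] [BorelSpace E] {ψ : E → ℝ} {K : NNReal} {s ρ : ℝ}

/-- The mean of the probability density proportional to `gibbsWeight ψ s x`, a multiple of the
viscous velocity at `x`. -/
def gibbsMean (ψ : E → ℝ) (s : ℝ) (x : E) : E :=
  (∫ z, gibbsWeight ψ s x z)⁻¹ • ∫ z, gibbsWeight ψ s x z • z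

theorem hasGradientAt_log_integral_gibbsWeight (hψ : LipschitzWith K ψ) (hs : 0 < s) (x : E) :
    HasGradientAt (fun x => Real.log (∫ z, gibbsWeight ψ s x z)) (s⁻¹ • gibbsMean ψ s x) x := by
  have h := (hasGradientAt_integral_gibbsWeight hψ hs x).hasFDerivAt.log
    (integral_gibbsWeight_pos hψ hs.le x).ne'
  rwa [← map_smul, smul_comm] at h

theorem exists_integral_norm_gibbsWeight_smul_le (hψ : LipschitzWith K ψ) (ρ : ℝ) :
    ∃ B : NNReal, ∀ s ∈ Icc 0 ρ, ∀ x,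
      ∫ z, ‖gibbsWeight ψ s x z • z‖ ≤ B * ∫ z, gibbsWeight ψ s x z := by
  set I₀ := ∫ z : E, Real.exp (-‖z‖ ^ 2 / 2 + -(K * ρ) * ‖z‖) with hI₀
  set I₁ := ∫ z : E, ‖z‖ * Real.exp (-‖z‖ ^ 2 / 2 + K * ρ * ‖z‖) with hI₁
  have hint₀ := integrable_exp_neg_norm_sq_add_mul_norm (E := E) (-(K * ρ))
  have hint₁ : Integrable fun z : E => ‖z‖ * Real.exp (-‖z‖ ^ 2 / 2 + K * ρ * ‖z‖) := by
    have := (integrable_mul_exp_mul_norm_smul (fun a => by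
      simpa only [Real.exp_add] using integrable_exp_neg_norm_sq_add_mul_norm (E := E) a)
      (K * ρ)).norm
    simpa [norm_smul, Real.exp_add, mul_comm] using this
  have hI₀_pos : 0 < I₀ := integral_exp_pos hint₀
  have hI₁_nonneg : 0 ≤ I₁ := integral_nonneg fun z => by positivity
  refine ⟨⟨I₁ / I₀, div_nonneg hI₁_nonneg hI₀_pos.le⟩, fun s hs x => ?_⟩
  calc ∫ z, ‖gibbsWeight ψ s x z • z‖ ≤ Real.exp (-ψ x) * I₁ := by
        rw [hI₁, ← integral_const_mul]
        refine integral_mono (integrable_gibbsWeight_smul hψ hs.1 x).norm (hint₁.const_mul _)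
          fun z => ?_
        rw [norm_smul, norm_gibbsWeight, mul_left_comm, mul_comm]
        exact mul_le_mul_of_nonneg_left (gibbsWeight_le hψ hs x z) (norm_nonneg z)
    _ = I₁ / I₀ * (Real.exp (-ψ x) * I₀) := by field_simp
    _ ≤ I₁ / I₀ * ∫ z, gibbsWeight ψ s x z := by
        gcongr
        rw [hI₀, ← integral_const_mul]
        exact integral_mono (hint₀.const_mul _) (integrable_gibbsWeight hψ hs.1 x)
          (le_gibbsWeight hψ hs x)

theorem norm_gibbsMean_le (hψ : LipschitzWith K ψ) (hs : 0 ≤ s) {x : E} {B : ℝ}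
    (hB : ∫ z, ‖gibbsWeight ψ s x z • z‖ ≤ B * ∫ z, gibbsWeight ψ s x z) :
    ‖gibbsMean ψ s x‖ ≤ B := by
  have hpos := integral_gibbsWeight_pos hψ hs x
  rw [gibbsMean, norm_smul, Real.norm_of_nonneg (inv_nonneg.mpr hpos.le), inv_mul_le_iff₀' hpos]
  exact (norm_integral_le_integral_norm _).trans hB

theorem integrable_gibbsWeight_smul_sub (hψ : LipschitzWith K ψ) (hs : 0 ≤ s) (x M : E) :
    Integrable fun z => gibbsWeight ψ s x z • (z - M) := by
  simp only [smul_sub]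
  exact (integrable_gibbsWeight_smul hψ hs x).sub
    ((integrable_gibbsWeight hψ hs x).smul_const M)

theorem integral_gibbsWeight_smul_sub (hψ : LipschitzWith K ψ) (hs : 0 ≤ s) (x M : E) :
    ∫ z, gibbsWeight ψ s x z • (z - M) =
      (∫ z, gibbsWeight ψ s x z) • (gibbsMean ψ s x - M) := by
  simp only [smul_sub]
  rw [integral_sub (integrable_gibbsWeight_smul hψ hs x)
    ((integrable_gibbsWeight hψ hs x).smul_const M), integral_smul_const, gibbsMean,
    smul_inv_smul₀ (integral_gibbsWeight_pos hψ hs x).ne']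

/-- With `D` the integral of the weight at `y`, `D (gibbsMean x - gibbsMean y)` is the integral of
the difference of the weights against `z - gibbsMean x`. -/
theorem norm_gibbsMean_sub_le (hψ : LipschitzWith K ψ) (hs : 0 ≤ s) {B : ℝ}
    (hB : ∀ x, ∫ z, ‖gibbsWeight ψ s x z • z‖ ≤ B * ∫ z, gibbsWeight ψ s x z) (x y : E) :
    ‖gibbsMean ψ s x - gibbsMean ψ s y‖ ≤ 2 * B * (Real.exp (K * ‖x - y‖) - 1) := by
  set M := gibbsMean ψ s x with hM
  set D := ∫ z, gibbsWeight ψ s y z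
  set c := Real.exp (K * ‖x - y‖) - 1
  have hD_pos : 0 < D := integral_gibbsWeight_pos hψ hs y
  have hc : 0 ≤ c := sub_nonneg.mpr (Real.one_le_exp (by positivity))
  have hint := (integrable_gibbsWeight_smul hψ hs y).norm
  have hint_M := (integrable_gibbsWeight hψ hs y).mul_const ‖M‖
  have hdiff : D • (M - gibbsMean ψ s y) =
      ∫ z, (gibbsWeight ψ s x z - gibbsWeight ψ s y z) • (z - M) := by
    simp only [sub_smul]
    rw [integral_sub (integrable_gibbsWeight_smul_sub hψ hs x M)
      (integrable_gibbsWeight_smul_sub hψ hs y M), integral_gibbsWeight_smul_sub hψ hs,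
      integral_gibbsWeight_smul_sub hψ hs, ← hM, sub_self, smul_zero, zero_sub, ← smul_neg,
      neg_sub]
  have hpoint : ∀ z, ‖(gibbsWeight ψ s x z - gibbsWeight ψ s y z) • (z - M)‖ ≤
      c * (‖gibbsWeight ψ s y z • z‖ + gibbsWeight ψ s y z * ‖M‖) := by
    intro z
    rw [norm_smul, norm_smul, norm_gibbsWeight, ← mul_add, ← mul_assoc]
    exact mul_le_mul (abs_gibbsWeight_sub_le hψ x y z) (norm_sub_le z M) (norm_nonneg _)
      (mul_nonneg hc (gibbsWeight_pos y z).le)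
  refine le_of_mul_le_mul_left ?_ hD_pos
  calc D * ‖M - gibbsMean ψ s y‖ = ‖D • (M - gibbsMean ψ s y)‖ := by
        rw [norm_smul, Real.norm_of_nonneg hD_pos.le]
    _ ≤ ∫ z, c * (‖gibbsWeight ψ s y z • z‖ + gibbsWeight ψ s y z * ‖M‖) := by
        rw [hdiff]
        exact norm_integral_le_of_norm_le ((hint.add hint_M).const_mul c) (ae_of_all _ hpoint)
    _ = c * ((∫ z, ‖gibbsWeight ψ s y z • z‖) + D * ‖M‖) := by
        rw [integral_const_mul, integral_add hint hint_M, integral_mul_const]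
    _ ≤ c * (B * D + D * B) := by
        gcongr
        exacts [hB y, norm_gibbsMean_le hψ hs (hB x)]
    _ = D * (2 * B * c) := by ring

theorem exists_lipschitzWith_gibbsMean (hψ : LipschitzWith K ψ) (ρ : ℝ) :
    ∃ C, ∀ s ∈ Icc 0 ρ, LipschitzWith C (gibbsMean ψ s) := by
  obtain ⟨B, hB⟩ := exists_integral_norm_gibbsWeight_smul_le hψ ρ
  refine ⟨4 * B * K, fun s hs => LipschitzWith.of_dist_le_mul fun x y => ?_⟩
  rw [dist_eq_norm, dist_eq_norm]
  push_cast
  rcases le_total (K * ‖x - y‖) 1 with hsmall | hlarge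
  · have hexp := Real.abs_exp_sub_one_le (x := K * ‖x - y‖) (by rwa [abs_of_nonneg (by positivity)])
    rw [abs_of_nonneg (by positivity : 0 ≤ K * ‖x - y‖)] at hexp
    calc ‖gibbsMean ψ s x - gibbsMean ψ s y‖ ≤ 2 * B * (Real.exp (K * ‖x - y‖) - 1) :=
          norm_gibbsMean_sub_le hψ hs.1 (hB s hs) x y
      _ ≤ 2 * B * (2 * (K * ‖x - y‖)) := by gcongr; exact (le_abs_self _).trans hexp
      _ = 4 * B * K * ‖x - y‖ := by ring
  · calc ‖gibbsMean ψ s x - gibbsMean ψ s y‖ ≤ B + B :=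
          norm_sub_le_of_le (norm_gibbsMean_le hψ hs.1 (hB s hs x))
            (norm_gibbsMean_le hψ hs.1 (hB s hs y))
      _ ≤ 4 * B * 1 := by linarith [B.coe_nonneg]
      _ ≤ 4 * B * (K * ‖x - y‖) := by gcongr
      _ = 4 * B * K * ‖x - y‖ := by ring

theorem continuousOn_gibbsMean (hψ : LipschitzWith K ψ) (ρ : ℝ) (x : E) :
    ContinuousOn (fun s => gibbsMean ψ s x) (Icc 0 ρ) := by
  have hmass : ContinuousOn (fun s => ∫ z, gibbsWeight ψ s x z) (Icc 0 ρ) := by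
    simpa using continuousOn_integral_gibbsWeight_smul (g := fun _ => (1 : ℝ)) hψ continuous_const
      (fun z => by simp) ρ x
  have hmoment := continuousOn_integral_gibbsWeight_smul hψ continuous_id
    (fun z => by rw [id_eq]; linarith [Real.add_one_le_exp ‖z‖]) ρ x
  exact (hmass.inv₀ fun s hs => (integral_gibbsWeight_pos hψ hs.1 x).ne').smul hmoment

end GibbsMean

section Solutions

variable {E : Type*} [NormedAddCommGroup E] [InnerProductSpace ℝ E] {V : ℝ → E → E} {y : E}
  {T : ℝ} {z z₁ z₂ : ℝ → E}

/-- `z` solves `∂ₜ z = V t z`, `z 0 = y` on `[0, T]`. As in `IsViscousPath`, the equation is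
required only inside the interval, where the viscous velocity is smooth. -/
def IsSolutionOn (V : ℝ → E → E) (y : E) (T : ℝ) (z : ℝ → E) : Prop :=
  z 0 = y ∧ ContinuousOn z (Icc 0 T) ∧ ∀ t ∈ Ioo 0 T, HasDerivAt z (V t (z t)) t

theorem IsSolutionOn.mono {T' : ℝ} (h : IsSolutionOn V y T z) (hT : T' ≤ T) :
    IsSolutionOn V y T' z :=
  ⟨h.1, h.2.1.mono (Icc_subset_Icc_right hT), fun t ht => h.2.2 t ⟨ht.1, ht.2.trans_le hT⟩⟩

theorem IsSolutionOn.eqOn (hV : ∀ t > 0, ∀ x₁ x₂, inner ℝ (V t x₁ - V t x₂) (x₁ - x₂) ≤ 0)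
    (h₁ : IsSolutionOn V y T z₁) (h₂ : IsSolutionOn V y T z₂) : EqOn z₁ z₂ (Icc 0 T) := by
  intro t ht
  refine eq_of_norm_sub_sq_nonpos ?_
  have h := norm_sub_sq_le_of_inner_deriv_le (δ := 0) h₁.2.1 h₂.2.1
    (fun s hs => ⟨_, _, h₁.2.2 s hs, h₂.2.2 s hs, hV s hs.1 _ _⟩) ht
  simpa [h₁.1, h₂.1] using h

theorem exists_forall_isSolutionOn
    (hV : ∀ t > 0, ∀ x₁ x₂, inner ℝ (V t x₁ - V t x₂) (x₁ - x₂) ≤ 0)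
    (hex : ∀ T, ∃ z, IsSolutionOn V y T z) : ∃ z, ∀ T, IsSolutionOn V y T z := by
  choose z hz using hex
  have heq : ∀ T, EqOn (fun t => z t t) (z T) (Icc 0 T) := fun T t ht =>
    (hz t).eqOn hV ((hz T).mono ht.2) ⟨ht.1, le_rfl⟩
  refine ⟨fun t => z t t, fun T => ⟨(hz 0).1, (hz T).2.1.congr (heq T), fun t ht => ?_⟩⟩
  have hder := (hz T).2.2 t ht
  rw [← heq T ⟨ht.1.le, ht.2.le⟩] at hder
  exact hder.congr_of_eventuallyEq ((heq T).eventuallyEq_of_mem (Icc_mem_nhds ht.1 ht.2))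

theorem exists_hasDerivWithinAt_gibbsMean [FiniteDimensional ℝ E] [MeasurableSpace E]
    [BorelSpace E] {ψ : E → ℝ} {K : NNReal} (hψ : LipschitzWith K ψ) {ρ : ℝ} (hρ : 0 ≤ ρ) (y : E) :
    ∃ α : ℝ → E, α 0 = y ∧
      ∀ s ∈ Icc 0 ρ, HasDerivWithinAt α (-(2 : ℝ) • gibbsMean ψ s (α s)) (Icc 0 ρ) s := by
  have := FiniteDimensional.complete ℝ E
  obtain ⟨B, hB⟩ := exists_integral_norm_gibbsWeight_smul_le hψ ρ
  obtain ⟨C, hC⟩ := exists_lipschitzWith_gibbsMean hψ ρ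
  have hpl : IsPicardLindelof (fun s x => -(2 : ℝ) • gibbsMean ψ s x)
      (⟨0, le_rfl, hρ⟩ : Icc 0 ρ) y (2 * B * ρ.toNNReal) 0 (2 * B) (‖-(2 : ℝ)‖₊ * C) := by
    refine ⟨fun s hs => ?_, fun x _ => ?_, fun s hs x _ => ?_, ?_⟩
    · exact ((lipschitzWith_smul (-(2 : ℝ))).comp (hC s hs)).lipschitzOnWith
    · exact (continuousOn_gibbsMean hψ ρ x).const_smul (-(2 : ℝ))
    · rw [norm_smul, norm_neg, Real.norm_ofNat]
      push_cast
      gcongr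
      exact norm_gibbsMean_le hψ hs.1 (hB s hs x)
    · simp [hρ]
  exact hpl.exists_eq_forall_mem_Icc_hasDerivWithinAt₀

end Solutions

section ViscousPotential

variable {d : ℕ} {φ : EuclideanSpace ℝ (Fin d) → ℝ} {L : NNReal} {ε t : ℝ}

local notation "𝔼" => EuclideanSpace ℝ (Fin d)

theorem exists_lipschitzWith_div_const (hφ : LipschitzWith L φ) (ε : ℝ) :
    ∃ K, LipschitzWith K fun y => φ y / ε := by
  refine ⟨‖ε⁻¹‖₊ * L, ?_⟩
  simpa only [div_eq_inv_mul, smul_eq_mul, Function.comp_def] using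
    (lipschitzWith_smul ε⁻¹).comp hφ

theorem integral_exp_eq_mul_integral_gibbsWeight (φ : 𝔼 → ℝ) (hε : 0 < ε) (ht : 0 < t) (x : 𝔼) :
    ∫ y, Real.exp (-‖x - y‖ ^ 2 / (2 * ε * t) - φ y / ε) =
      √(ε * t) ^ d * ∫ z, gibbsWeight (fun y => φ y / ε) √(ε * t) x z := by
  have hpos : 0 < √(ε * t) := Real.sqrt_pos.mpr (mul_pos hε ht)
  have hweight : ∀ z : 𝔼, gibbsWeight (fun y => φ y / ε) √(ε * t) x z =
      Real.exp (-‖x - (x + √(ε * t) • z)‖ ^ 2 / (2 * ε * t) - φ (x + √(ε * t) • z) / ε) := by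
    intro z
    rw [gibbsWeight, sub_add_cancel_left, norm_neg, norm_smul, mul_pow, Real.norm_of_nonneg hpos.le,
      Real.sq_sqrt (mul_pos hε ht).le]
    congr 2
    field_simp
  simp only [hweight]
  rw [Measure.integral_comp_smul volume
    (fun y : 𝔼 => Real.exp (-‖x - (x + y)‖ ^ 2 / (2 * ε * t) - φ (x + y) / ε)),
    integral_add_left_eq_self
    (fun y : 𝔼 => Real.exp (-‖x - y‖ ^ 2 / (2 * ε * t) - φ y / ε)) x,
    finrank_euclideanSpace_fin, abs_of_pos (by positivity), smul_eq_mul,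
    mul_inv_cancel_left₀ (by positivity)]

theorem viscousPotential_eq (hφ : LipschitzWith L φ) (hε : 0 < ε) (ht : 0 < t) (x : 𝔼) :
    viscousPotential φ ε t x = ε * Real.log ((2 * Real.pi) ^ ((d : ℝ) / 2)) -
      ε * Real.log (∫ z, gibbsWeight (fun y => φ y / ε) √(ε * t) x z) := by
  obtain ⟨K, hψ⟩ := exists_lipschitzWith_div_const hφ ε
  have hI := integral_gibbsWeight_pos hψ (Real.sqrt_nonneg (ε * t)) x
  have hnorm : (2 * Real.pi * ε * t) ^ ((d : ℝ) / 2) =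
      (2 * Real.pi) ^ ((d : ℝ) / 2) * √(ε * t) ^ d := by
    rw [mul_assoc, Real.mul_rpow (by positivity) (by positivity), Real.sqrt_eq_rpow,
      ← Real.rpow_natCast, ← Real.rpow_mul (by positivity)]
    ring_nf
  have hc : 1 / ((2 * Real.pi) ^ ((d : ℝ) / 2) * √(ε * t) ^ d) * √(ε * t) ^ d =
      ((2 * Real.pi) ^ ((d : ℝ) / 2))⁻¹ := by
    field_simp
  rw [viscousPotential, integral_exp_eq_mul_integral_gibbsWeight φ hε ht, hnorm, ← mul_assoc, hc,
    Real.log_mul (by positivity) hI.ne', Real.log_inv]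
  ring

theorem concaveOn_viscousPotential (hφ : LipschitzWith L φ) (hconc : ConcaveOn ℝ univ φ)
    (hε : 0 < ε) (ht : 0 < t) : ConcaveOn ℝ univ (viscousPotential φ ε t) := by
  obtain ⟨K, hψ⟩ := exists_lipschitzWith_div_const hφ ε
  have hconc' : ConcaveOn ℝ univ fun y => φ y / ε := by
    simpa only [div_eq_inv_mul, smul_eq_mul] using hconc.smul (inv_nonneg.mpr hε.le)
  rw [funext (viscousPotential_eq hφ hε ht)]
  exact (concaveOn_const _ convex_univ).sub
    ((convexOn_log_integral_gibbsWeight hψ hconc' (Real.sqrt_nonneg _)).smul hε.le)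

theorem hasGradientAt_viscousPotential (hφ : LipschitzWith L φ) (hε : 0 < ε) (ht : 0 < t) (x : 𝔼) :
    HasGradientAt (viscousPotential φ ε t)
      (-(ε / √(ε * t)) • gibbsMean (fun y => φ y / ε) √(ε * t) x) x := by
  obtain ⟨K, hψ⟩ := exists_lipschitzWith_div_const hφ ε
  have hlog := hasGradientAt_log_integral_gibbsWeight hψ (Real.sqrt_pos.mpr (mul_pos hε ht)) x
  rw [funext (viscousPotential_eq hφ hε ht), hasGradientAt_iff_hasFDerivAt]
  refine ((hlog.hasFDerivAt.const_mul ε).const_sub _).congr_fderiv ?_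
  rw [← map_smul, ← map_neg, smul_smul, ← neg_smul, div_eq_mul_inv]

theorem isSupergradient_gradient_viscousPotential (hφ : LipschitzWith L φ)
    (hconc : ConcaveOn ℝ univ φ) (hε : 0 < ε) (ht : 0 < t) (x : 𝔼) :
    IsSupergradient (viscousPotential φ ε t) 0 x (gradient (viscousPotential φ ε t) x) :=
  isSupergradient_of_hasGradientAt (concaveOn_viscousPotential hφ hconc hε ht)
    (hasGradientAt_viscousPotential hφ hε ht x).differentiableAt.hasGradientAt

theorem inner_gradient_viscousPotential_sub_le (hφ : LipschitzWith L φ)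
    (hconc : ConcaveOn ℝ univ φ) (hε : 0 < ε) (ht : 0 < t) (x₁ x₂ : 𝔼) :
    inner ℝ (gradient (viscousPotential φ ε t) x₁ - gradient (viscousPotential φ ε t) x₂)
      (x₁ - x₂) ≤ 0 := by
  simpa using (isSupergradient_gradient_viscousPotential hφ hconc hε ht x₁).inner_sub_sub_le
    (isSupergradient_gradient_viscousPotential hφ hconc hε ht x₂)

end ViscousPotential

section ViscousPath

variable {d : ℕ} {φ : EuclideanSpace ℝ (Fin d) → ℝ} {L : NNReal} {ε : ℝ}

local notation "𝔼" => EuclideanSpace ℝ (Fin d)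

theorem isViscousPath_iff_forall_isSolutionOn {y : 𝔼} {z : ℝ → 𝔼} : IsViscousPath φ ε y z ↔
    ∀ T, IsSolutionOn (fun t => gradient (viscousPotential φ ε t)) y T z := by
  refine ⟨fun h T => ⟨h.1, h.2.1.mono Icc_subset_Ici_self, fun t ht => h.2.2 t ht.1⟩,
    fun h => ⟨(h 0).1, ?_, fun t ht => (h (t + 1)).2.2 t ⟨ht, by linarith⟩⟩⟩
  refine continuousOn_of_locally_continuousOn fun t _ => ⟨Iio (t + 1), isOpen_Iio, by simp, ?_⟩
  exact (h (t + 1)).2.1.mono fun s hs => ⟨hs.1, le_of_lt hs.2⟩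

/-- The viscous velocity blows up like `t ^ (-1 / 2)` at `t = 0`; the time change `s = √(ε t)` turns
the equation into `α' = -2 gibbsMean (φ / ε) s α`, whose right-hand side is Lipschitz up to
`s = 0`. -/
theorem exists_isSolutionOn_gradient_viscousPotential (hφ : LipschitzWith L φ) (hε : 0 < ε)
    (T : ℝ) (y : 𝔼) :
    ∃ z, IsSolutionOn (fun t => gradient (viscousPotential φ ε t)) y T z := by
  obtain ⟨K, hψ⟩ := exists_lipschitzWith_div_const hφ ε
  obtain ⟨α, hα0, hα⟩ :=
    exists_hasDerivWithinAt_gibbsMean hψ (Real.sqrt_nonneg (ε * T)) y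
  have hαc : ContinuousOn α (Icc 0 √(ε * T)) := fun s hs => (hα s hs).continuousWithinAt
  refine ⟨fun t => α √(ε * t), by simpa using hα0, ?_, fun t ht => ?_⟩
  · exact hαc.comp (by fun_prop) fun t ht => ⟨Real.sqrt_nonneg _, by gcongr; exact ht.2⟩
  have hpos : 0 < √(ε * t) := Real.sqrt_pos.mpr (mul_pos hε ht.1)
  have hlt : √(ε * t) < √(ε * T) :=
    Real.sqrt_lt_sqrt (mul_pos hε ht.1).le (by gcongr; exact ht.2)
  have hsqrt : HasDerivAt (fun t => √(ε * t)) (ε / (2 * √(ε * t))) t := by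
    simpa using ((hasDerivAt_id t).const_mul ε).sqrt (mul_pos hε ht.1).ne'
  have hder := ((hα _ ⟨hpos.le, hlt.le⟩).hasDerivAt (Icc_mem_nhds hpos hlt)).scomp t hsqrt
  refine (hder.congr_deriv ?_).congr_deriv
    (hasGradientAt_viscousPotential hφ hε ht.1 _).gradient.symm
  rw [smul_smul]
  congr 1
  field_simp

theorem exists_isViscousPath (hφ : LipschitzWith L φ) (hconc : ConcaveOn ℝ univ φ) (hε : 0 < ε)
    (y : 𝔼) : ∃ z, IsViscousPath φ ε y z := by
  simp only [isViscousPath_iff_forall_isSolutionOn]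
  exact exists_forall_isSolutionOn
    (fun t ht => inner_gradient_viscousPotential_sub_le hφ hconc hε ht)
    fun T => exists_isSolutionOn_gradient_viscousPotential hφ hε T y

theorem IsViscousPath.eqOn (hφ : LipschitzWith L φ) (hconc : ConcaveOn ℝ univ φ) (hε : 0 < ε)
    {y : 𝔼} {z₁ z₂ : ℝ → 𝔼} (h₁ : IsViscousPath φ ε y z₁) (h₂ : IsViscousPath φ ε y z₂) :
    EqOn z₁ z₂ (Ici 0) := fun t ht =>
  (isViscousPath_iff_forall_isSolutionOn.mp h₁ t).eqOn
    (fun _ ht => inner_gradient_viscousPotential_sub_le hφ hconc hε ht)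
    (isViscousPath_iff_forall_isSolutionOn.mp h₂ t) ⟨ht, le_rfl⟩

theorem isViscousPath_viscousFlow (hφ : LipschitzWith L φ) (hconc : ConcaveOn ℝ univ φ)
    (hε : 0 < ε) (y : 𝔼) : IsViscousPath φ ε y (fun t => viscousFlow φ ε t y) :=
  Classical.epsilon_spec (exists_isViscousPath hφ hconc hε y)

end ViscousPath

section Bounds

theorem exists_tendsto_of_norm_sub_sq_le {E : Type*} [NormedAddCommGroup E] [CompleteSpace E]
    {z : ℝ → E} {C : ℝ} (h : ∀ ε > 0, ∀ ε' > 0, ‖z ε - z ε'‖ ^ 2 ≤ C * (ε + ε')) :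
    ∃ x, Tendsto z (𝓝[>] 0) (𝓝 x) := by
  have hlim : Tendsto (fun p : ℝ × ℝ => C * (p.1 + p.2)) (𝓝[>] 0 ×ˢ 𝓝[>] 0) (𝓝 0) := by
    have : Tendsto (fun p : ℝ × ℝ => C * (p.1 + p.2)) (𝓝 0 ×ˢ 𝓝 0) (𝓝 (C * (0 + 0))) :=
      (tendsto_fst.add tendsto_snd).const_mul C
    simpa using this.mono_left (prod_mono nhdsWithin_le_nhds nhdsWithin_le_nhds)
  have hsq : Tendsto (fun p : ℝ × ℝ => ‖z p.1 - z p.2‖ ^ 2) (𝓝[>] 0 ×ˢ 𝓝[>] 0) (𝓝 0) :=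
    squeeze_zero' (.of_forall fun _ => sq_nonneg _)
      ((eventually_mem_nhdsWithin.prod_mk eventually_mem_nhdsWithin).mono
        fun p hp => h p.1 hp.1 p.2 hp.2) hlim
  refine cauchy_map_iff_exists_tendsto.mp (cauchy_map_iff.mpr ⟨inferInstance, ?_⟩)
  rw [tendsto_uniformity_iff_dist_tendsto_zero]
  simpa [dist_eq_norm] using hsq.sqrt

theorem integral_gibbsWeight_inner {E : Type*} [NormedAddCommGroup E] [InnerProductSpace ℝ E]
    [FiniteDimensional ℝ E] [MeasurableSpace E] [BorelSpace E] (a : E) (s : ℝ) (x : E) :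
    ∫ z, gibbsWeight (fun y => inner ℝ a y) s x z =
      Real.exp (s ^ 2 * ‖a‖ ^ 2 / 2 - inner ℝ a x) *
        (2 * Real.pi) ^ (Module.finrank ℝ E / 2 : ℝ) := by
  rw [← integral_exp_neg_norm_sq_div_two, ← integral_const_mul,
    ← integral_add_right_eq_self (fun z : E => _ * Real.exp (-‖z‖ ^ 2 / 2)) (s • a)]
  refine integral_congr_ae (ae_of_all _ fun z => ?_)
  simp only [gibbsWeight, ← Real.exp_add]
  rw [norm_add_sq_real, norm_smul, mul_pow, Real.norm_eq_abs, sq_abs, inner_add_right,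
    real_inner_smul_right, real_inner_smul_right, real_inner_comm a z]
  ring_nf

variable {d : ℕ} {ε t : ℝ}

local notation "𝔼" => EuclideanSpace ℝ (Fin d)

theorem lipschitzWith_inner (p : 𝔼) : LipschitzWith ‖p‖₊ fun y => (inner ℝ p y : ℝ) := by
  simpa [nnnorm, innerSL_apply_norm] using (innerSL ℝ p).lipschitz

theorem viscousPotential_inner (p : 𝔼) (hε : 0 < ε) (ht : 0 < t) (x : 𝔼) :
    viscousPotential (fun y => inner ℝ p y) ε t x = inner ℝ p x - t * ‖p‖ ^ 2 / 2 := by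
  have hscale : (fun y : 𝔼 => inner ℝ p y / ε) = fun y => inner ℝ (ε⁻¹ • p) y := by
    ext y
    rw [real_inner_smul_left, div_eq_inv_mul]
  rw [viscousPotential_eq (lipschitzWith_inner p) hε ht, hscale, integral_gibbsWeight_inner,
    finrank_euclideanSpace_fin, Real.log_mul (by positivity) (by positivity), Real.log_exp,
    Real.sq_sqrt (by positivity), norm_smul, real_inner_smul_left, Real.norm_of_nonneg
    (by positivity)]
  field_simp
  ring

theorem viscousPotential_mono {φ φ' : 𝔼 → ℝ} {L L' : NNReal} (hφ : LipschitzWith L φ)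
    (hφ' : LipschitzWith L' φ') (hle : ∀ y, φ y ≤ φ' y) (hε : 0 < ε) (ht : 0 < t) (x : 𝔼) :
    viscousPotential φ ε t x ≤ viscousPotential φ' ε t x := by
  obtain ⟨K, hψ⟩ := exists_lipschitzWith_div_const hφ ε
  obtain ⟨K', hψ'⟩ := exists_lipschitzWith_div_const hφ' ε
  have hs := Real.sqrt_nonneg (ε * t)
  rw [viscousPotential_eq hφ hε ht, viscousPotential_eq hφ' hε ht]
  gcongr ε * _ - ε * Real.log ?_
  · exact integral_gibbsWeight_pos hψ' hs x
  · refine integral_mono (integrable_gibbsWeight hψ' hs x) (integrable_gibbsWeight hψ hs x)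
      fun z => ?_
    rw [gibbsWeight, gibbsWeight]
    have := hle (x + √(ε * t) • z)
    gcongr

/-- The minimum of the data exponentiates to a sum, up to a factor `Fintype.card ι`, and the
Cole-Hopf integral is additive. -/
theorem sub_mul_log_card_le_viscousPotential {ι : Type*} [Fintype ι] {φ : 𝔼 → ℝ} {L : NNReal}
    {φs : ι → 𝔼 → ℝ} {Ls : ι → NNReal} (hφ : LipschitzWith L φ)
    (hφs : ∀ i, LipschitzWith (Ls i) (φs i)) (hle : ∀ y, ∃ i, φs i y ≤ φ y) (hε : 0 < ε)
    (ht : 0 < t) {x : 𝔼} {a : ℝ} (ha : ∀ i, a ≤ viscousPotential (φs i) ε t x) :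
    a - ε * Real.log (Fintype.card ι) ≤ viscousPotential φ ε t x := by
  obtain ⟨K, hψ⟩ := exists_lipschitzWith_div_const hφ ε
  choose Ks hψs using fun i => exists_lipschitzWith_div_const (hφs i) ε
  have hs := Real.sqrt_nonneg (ε * t)
  set I := ∫ z, gibbsWeight (fun y => φ y / ε) √(ε * t) x z
  set c := ε * Real.log ((2 * Real.pi) ^ ((d : ℝ) / 2))
  have hI_pos : 0 < I := integral_gibbsWeight_pos hψ hs x
  have hcard : 0 < (Fintype.card ι : ℝ) := by
    exact_mod_cast Fintype.card_pos_iff.mpr ⟨(hle 0).choose⟩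
  have hsum : I ≤ ∑ i, ∫ z, gibbsWeight (fun y => φs i y / ε) √(ε * t) x z := by
    rw [← integral_finsetSum _ fun i _ => integrable_gibbsWeight (hψs i) hs x]
    refine integral_mono (integrable_gibbsWeight hψ hs x)
      (integrable_finsetSum _ fun i _ => integrable_gibbsWeight (hψs i) hs x) fun z => ?_
    obtain ⟨i, hi⟩ := hle (x + √(ε * t) • z)
    calc gibbsWeight (fun y => φ y / ε) √(ε * t) x z
        ≤ gibbsWeight (fun y => φs i y / ε) √(ε * t) x z := by rw [gibbsWeight, gibbsWeight]; gcongr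
      _ ≤ _ := Finset.single_le_sum (f := fun i => gibbsWeight (fun y => φs i y / ε) _ x z)
          (fun i _ => (gibbsWeight_pos x z).le) (Finset.mem_univ i)
  have hterm : ∀ i, ∫ z, gibbsWeight (fun y => φs i y / ε) √(ε * t) x z ≤
      Real.exp ((c - a) / ε) := by
    intro i
    have hai := ha i
    rw [viscousPotential_eq (hφs i) hε ht] at hai
    rw [← Real.log_le_iff_le_exp (integral_gibbsWeight_pos (hψs i) hs x), le_div_iff₀' hε]
    linarith
  have hlog : Real.log I ≤ Real.log (Fintype.card ι) + (c - a) / ε := by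
    rw [Real.log_le_iff_le_exp hI_pos, Real.exp_add, Real.exp_log hcard]
    simpa using hsum.trans (Finset.sum_le_sum fun i _ => hterm i)
  have hmul := mul_le_mul_of_nonneg_left hlog hε.le
  rw [mul_add, mul_div_cancel₀ _ hε.ne'] at hmul
  rw [viscousPotential_eq hφ hε ht]
  linarith

end Bounds

section ConcyclicVelocities

variable {d : ℕ} {ι : Type*} {v : ι → EuclideanSpace ℝ (Fin d)} {q : EuclideanSpace ℝ (Fin d)}
  {R ε t : ℝ}

local notation "𝔼" => EuclideanSpace ℝ (Fin d)

/-- In the frame moving with the centre `q` the inviscid potential is stationary up to an additive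
constant. -/
theorem inner_add_smul_sub_of_norm_sub_eq {p : 𝔼} (hp : ‖p - q‖ = R) (t : ℝ) (x : 𝔼) :
    inner ℝ p (x + t • q) - t * ‖p‖ ^ 2 / 2 = inner ℝ p x + t * (‖q‖ ^ 2 - R ^ 2) / 2 := by
  rw [← hp, norm_sub_sq_real, inner_add_right, real_inner_smul_right]
  ring

variable [Fintype ι] [Nonempty ι]

theorem viscousPotential_minInner_le (hR : ∀ i, ‖v i - q‖ = R) (hε : 0 < ε) (ht : 0 < t) (x : 𝔼) :
    viscousPotential (minInner v) ε t (x + t • q) ≤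
      minInner v x + t * (‖q‖ ^ 2 - R ^ 2) / 2 := by
  obtain ⟨K, hK⟩ := exists_lipschitzWith_minInner v
  obtain ⟨i, hi⟩ := exists_inner_eq_minInner v x
  rw [← hi, ← inner_add_smul_sub_of_norm_sub_eq (hR i), ← viscousPotential_inner _ hε ht]
  exact viscousPotential_mono hK (lipschitzWith_inner _) (fun y => minInner_le y i) hε ht _

theorem le_viscousPotential_minInner (hR : ∀ i, ‖v i - q‖ = R) (hε : 0 < ε) (ht : 0 < t) (x : 𝔼) :
    minInner v x + t * (‖q‖ ^ 2 - R ^ 2) / 2 - ε * Real.log (Fintype.card ι) ≤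
      viscousPotential (minInner v) ε t (x + t • q) := by
  obtain ⟨K, hK⟩ := exists_lipschitzWith_minInner v
  refine sub_mul_log_card_le_viscousPotential hK (fun i => lipschitzWith_inner (v i))
    (fun y => (exists_inner_eq_minInner v y).imp fun _ => le_of_eq) hε ht fun i => ?_
  rw [viscousPotential_inner _ hε ht, inner_add_smul_sub_of_norm_sub_eq (hR i)]
  gcongr
  exact minInner_le x i

theorem IsViscousPath.isApproxGradientPath (hR : ∀ i, ‖v i - q‖ = R) (hε : 0 < ε) {y : 𝔼}
    {z : ℝ → 𝔼} (hz : IsViscousPath (minInner v) ε y z) (T : ℝ) :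
    IsApproxGradientPath (minInner fun i => v i - q) (ε * Real.log (Fintype.card ι)) T
      (fun t => z t - t • q) := by
  obtain ⟨K, hK⟩ := exists_lipschitzWith_minInner v
  have hframe : ∀ t : ℝ, HasDerivAt (fun t : ℝ => t • q) q t := fun t => by
    simpa using (hasDerivAt_id t).smul_const q
  refine ⟨(hz.2.1.mono Icc_subset_Ici_self).sub (by fun_prop), fun t ht =>
    ⟨_, (hz.2.2 t ht.1).sub (hframe t), fun w => ?_⟩⟩
  have hsuper := isSupergradient_gradient_viscousPotential hK (concaveOn_minInner v) hε ht.1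
    (z t) (w + t • q)
  have hlow := le_viscousPotential_minInner hR hε ht.1 w
  have hup := viscousPotential_minInner_le hR hε ht.1 (z t - t • q)
  rw [sub_add_cancel] at hup
  rw [show w + t • q - z t = w - (z t - t • q) by abel] at hsuper
  simp only [minInner_sub, inner_sub_left, inner_sub_right q]
  linarith

theorem norm_viscousFlow_sub_sq_le (hR : ∀ i, ‖v i - q‖ = R) {ε' : ℝ} (hε : 0 < ε) (hε' : 0 < ε')
    (ht : 0 ≤ t) (y : 𝔼) :
    ‖viscousFlow (minInner v) ε t y - viscousFlow (minInner v) ε' t y‖ ^ 2 ≤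
      2 * Real.log (Fintype.card ι) * t * (ε + ε') := by
  obtain ⟨K, hK⟩ := exists_lipschitzWith_minInner v
  have hz := isViscousPath_viscousFlow hK (concaveOn_minInner v) hε y
  have hz' := isViscousPath_viscousFlow hK (concaveOn_minInner v) hε' y
  have h := (hz.isApproxGradientPath hR hε t).norm_sub_sq_le (hz'.isApproxGradientPath hR hε' t)
    ⟨ht, le_rfl⟩
  simp only [sub_sub_sub_cancel_right, hz.1, hz'.1, sub_self, norm_zero] at h
  linarith

theorem tendsto_viscousFlow (hR : ∀ i, ‖v i - q‖ = R) (ht : 0 ≤ t) (y : 𝔼) :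
    Tendsto (fun ε => viscousFlow (minInner v) ε t y) (𝓝[>] 0)
      (𝓝 (lagrangianFlow (minInner v) t y)) :=
  tendsto_nhds_limUnder (exists_tendsto_of_norm_sub_sq_le fun _ hε _ hε' =>
    norm_viscousFlow_sub_sq_le hR hε hε' ht y)

/-- The error `ε log (card ι)` is at most `δ` for `ε = δ / (log (card ι) + 1)`, where the `1` keeps
the denominator positive. -/
theorem isGradientFlow_lagrangianFlow (hR : ∀ i, ‖v i - q‖ = R) :
    IsGradientFlow (minInner fun i => v i - q)
      (fun t y => lagrangianFlow (minInner v) t y - t • q) := by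
  obtain ⟨K, hK⟩ := exists_lipschitzWith_minInner v
  intro y
  set c := Real.log (Fintype.card ι) + 1
  have hc_pos : 0 < c := by positivity
  have hpath := fun {δ : ℝ} (hδ : 0 < δ) =>
    isViscousPath_viscousFlow hK (concaveOn_minInner v) (div_pos hδ hc_pos) y
  refine ⟨fun δ t => viscousFlow (minInner v) (δ / c) t y - t • q,
    fun δ hδ => ⟨by simpa using (hpath hδ).1, fun T => ?_⟩, fun t ht => ?_⟩
  · refine ((hpath hδ).isApproxGradientPath hR (div_pos hδ hc_pos) T).mono ?_
    rw [div_mul_eq_mul_div, div_le_iff₀ hc_pos]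
    gcongr
    linarith
  · have hscale : Tendsto (fun δ => δ / c) (𝓝[>] 0) (𝓝[>] 0) := by
      simp only [div_eq_inv_mul]
      exact tendsto_comap.mono_left (comap_mulLeft_nhdsGT_zero (inv_pos.mpr hc_pos)).ge
    exact ((tendsto_viscousFlow hR ht y).comp hscale).sub_const _

theorem continuous_lagrangianFlow (hR : ∀ i, ‖v i - q‖ = R) (ht : 0 ≤ t) :
    Continuous (lagrangianFlow (minInner v) t) := by
  simpa only [sub_add_cancel] using
    ((isGradientFlow_lagrangianFlow hR).continuous ht).fun_add (continuous_const (y := t • q))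

end ConcyclicVelocities

section MongeAmpere

variable {d : ℕ} {ι : Type*} [Fintype ι] [Nonempty ι] {v : ι → EuclideanSpace ℝ (Fin d)}
  {q : EuclideanSpace ℝ (Fin d)} {R t : ℝ}

local notation "𝔼" => EuclideanSpace ℝ (Fin d)

theorem convexPotential_minInner (ht : 0 ≤ t) (x : 𝔼) :
    convexPotential (minInner v) t x = ⨆ i, ‖x - t • v i‖ ^ 2 / 2 := by
  have hsq : ∀ i y, inner ℝ x y - ‖y‖ ^ 2 / 2 - t * inner ℝ (v i) y =
      ‖x - t • v i‖ ^ 2 / 2 - ‖x - t • v i - y‖ ^ 2 / 2 := by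
    intro i y
    rw [norm_sub_sq_real (x - t • v i) y, inner_sub_left, real_inner_smul_left]
    ring
  have hle : ∀ y, inner ℝ x y - ‖y‖ ^ 2 / 2 - t * minInner v y ≤ ⨆ i, ‖x - t • v i‖ ^ 2 / 2 := by
    intro y
    obtain ⟨i, hi⟩ := exists_inner_eq_minInner v y
    rw [← hi, hsq]
    exact (sub_le_self _ (by positivity)).trans
      (le_ciSup (f := fun i => ‖x - t • v i‖ ^ 2 / 2) (finite_range _).bddAbove i)
  refine le_antisymm (ciSup_le hle) (ciSup_le fun i => ?_)
  refine le_trans ?_ (le_ciSup (f := fun y => inner ℝ x y - ‖y‖ ^ 2 / 2 - t * minInner v y)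
    ⟨_, forall_mem_range.mpr hle⟩ (x - t • v i))
  calc ‖x - t • v i‖ ^ 2 / 2
      = inner ℝ x (x - t • v i) - ‖x - t • v i‖ ^ 2 / 2 - t * inner ℝ (v i) (x - t • v i) := by
        simp [hsq]
    _ ≤ _ := by gcongr; exact minInner_le _ i

theorem convexPotential_minInner_eq (hR : ∀ i, ‖v i - q‖ = R) (ht : 0 ≤ t) (x : 𝔼) :
    convexPotential (minInner v) t x = ‖x - t • q‖ ^ 2 / 2 + t ^ 2 * R ^ 2 / 2 -
      t * minInner (fun i => v i - q) (x - t • q) := by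
  have hsq : ∀ i, ‖x - t • v i‖ ^ 2 / 2 = ‖x - t • q‖ ^ 2 / 2 + t ^ 2 * R ^ 2 / 2 -
      t * inner ℝ (v i - q) (x - t • q) := by
    intro i
    rw [show x - t • v i = (x - t • q) - t • (v i - q) by module, norm_sub_sq_real, norm_smul,
      mul_pow, hR, Real.norm_eq_abs, sq_abs, real_inner_smul_right, real_inner_comm]
    ring
  rw [convexPotential_minInner ht]
  simp only [hsq]
  obtain ⟨i, hi⟩ := exists_inner_eq_minInner (fun i => v i - q) (x - t • q)
  refine le_antisymm (ciSup_le fun j => ?_) ?_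
  · gcongr
    exact minInner_le (b := fun i => v i - q) _ j
  · rw [← hi]
    exact le_ciSup (f := fun i => ‖x - t • q‖ ^ 2 / 2 + t ^ 2 * R ^ 2 / 2 -
      t * inner ℝ (v i - q) (x - t • q)) (finite_range _).bddAbove i

theorem convexPotential_add_inner_add_le (hR : ∀ i, ‖v i - q‖ = R) (ht : 0 ≤ t) {x y : 𝔼}
    (h : IsResolvent (minInner fun i => v i - q) t y (x - t • q)) (z : 𝔼) :
    convexPotential (minInner v) t x + inner ℝ y (z - x) + ‖z - x‖ ^ 2 / 2 ≤
      convexPotential (minInner v) t z := by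
  have hz := h (z - t • q)
  rw [inner_sub_left, inner_sub_right (x - t • q), real_inner_self_eq_norm_sq] at hz
  rw [convexPotential_minInner_eq hR ht, convexPotential_minInner_eq hR ht,
    ← sub_sub_sub_cancel_right z x (t • q), norm_sub_sq_real (z - t • q),
    real_inner_comm (x - t • q) (z - t • q)]
  linarith

/-- Since `w_t` grows quadratically away from `x + tq`, where `x` is the resolvent of `y`, no other
point can have `y` as a subgradient. -/
theorem mem_subgradient_convexPotential_iff (hR : ∀ i, ‖v i - q‖ = R) (ht : 0 ≤ t) {x y : 𝔼} :
    y ∈ subgradient (convexPotential (minInner v) t) x ↔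
      IsResolvent (minInner fun i => v i - q) t y (x - t • q) := by
  refine ⟨fun hy => ?_, fun h z => ?_⟩
  · obtain ⟨x', hx'⟩ := exists_isResolvent_minInner (fun i => v i - q) ht y
    rw [← add_sub_cancel_right x' (t • q)] at hx'
    have hgrowth := convexPotential_add_inner_add_le hR ht hx' x
    have hsub := hy (x' + t • q)
    rw [← neg_sub x, inner_neg_right] at hsub
    have hnorm : ‖x - (x' + t • q)‖ ^ 2 ≤ 0 := by linarith
    rwa [eq_of_norm_sub_sq_nonpos hnorm]
  · have := convexPotential_add_inner_add_le hR ht h z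
    linarith [sq_nonneg ‖z - x‖]

theorem biUnion_subgradient_convexPotential (hR : ∀ i, ‖v i - q‖ = R) (ht : 0 ≤ t) {S : 𝔼 → 𝔼}
    (hS : ∀ y, IsResolvent (minInner fun i => v i - q) t y (S y - t • q)) (B : Set 𝔼) :
    ⋃ x ∈ B, subgradient (convexPotential (minInner v) t) x = S ⁻¹' B := by
  ext y
  simp only [mem_preimage, mem_iUnion₂, mem_subgradient_convexPotential_iff hR ht, exists_prop]
  exact ⟨fun ⟨x, hx, hxy⟩ => sub_left_injective (hxy.unique (hS y)) ▸ hx, fun h => ⟨_, h, hS y⟩⟩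

theorem isMongeAmpereMeasure_map (hR : ∀ i, ‖v i - q‖ = R) (ht : 0 ≤ t) {S : 𝔼 → 𝔼}
    (hS : ∀ y, IsResolvent (minInner fun i => v i - q) t y (S y - t • q)) :
    IsMongeAmpereMeasure (convexPotential (minInner v) t) (Measure.map S volume) := by
  have hlip : LipschitzWith 1 S := LipschitzWith.of_dist_le_mul fun y₁ y₂ => by
    simpa [dist_eq_norm] using (hS y₁).norm_sub_le (hS y₂)
  intro B hB
  rw [Measure.map_apply hlip.continuous.measurable hB, biUnion_subgradient_convexPotential hR ht hS]

theorem isMongeAmpereMeasure_mongeAmpere (hR : ∀ i, ‖v i - q‖ = R) (ht : 0 ≤ t) :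
    IsMongeAmpereMeasure (convexPotential (minInner v) t)
      (mongeAmpere (convexPotential (minInner v) t)) := by
  choose J hJ using exists_isResolvent_minInner (fun i => v i - q) ht
  exact Classical.epsilon_spec ⟨_, isMongeAmpereMeasure_map (S := fun y => J y + t • q) hR ht
    fun y => by simpa using hJ y⟩

theorem IsMongeAmpereMeasure.unique {w : 𝔼 → ℝ} {μ ν : Measure 𝔼} (hμ : IsMongeAmpereMeasure w μ)
    (hν : IsMongeAmpereMeasure w ν) : μ = ν :=
  Measure.ext fun B hB => (hμ B hB).trans (hν B hB).symm

open scoped Pointwise in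
theorem mongeAmpere_singleton_pos (hR : ∀ i, ‖v i - q‖ = R)
    (hspan : affineSpan ℝ (range v) = ⊤) (ht : 0 < t) :
    0 < mongeAmpere (convexPotential (minInner v) t) {t • q} := by
  have hsub : -t • ((· + q) ⁻¹' convexHull ℝ (range v)) ⊆
      ⋃ x ∈ ({t • q} : Set 𝔼), subgradient (convexPotential (minInner v) t) x := by
    rintro _ ⟨p, hp, rfl⟩
    simp only [mem_singleton_iff, iUnion_iUnion_eq_left,
      mem_subgradient_convexPotential_iff hR ht.le, sub_self]
    exact isResolvent_minInner_zero ht.le (mem_convexHull_range_sub_iff.mpr hp)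
  rw [isMongeAmpereMeasure_mongeAmpere hR ht.le _ (measurableSet_singleton _)]
  refine lt_of_lt_of_le ?_ (measure_mono hsub)
  rw [Measure.addHaar_smul, measure_preimage_add_right]
  have hint := interior_convexHull_nonempty_iff_affineSpan_eq_top.mpr hspan
  have hscale : 0 < |(-t) ^ Module.finrank ℝ 𝔼| :=
    abs_pos.mpr (pow_ne_zero _ (neg_ne_zero.mpr ht.ne'))
  exact ENNReal.mul_pos (ENNReal.ofReal_pos.mpr hscale).ne'
    (Measure.measure_pos_of_nonempty_interior volume hint).ne'

end MongeAmpere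

section ThreeVelocities

variable {d : ℕ} {v : Fin 3 → EuclideanSpace ℝ (Fin d)} {q : EuclideanSpace ℝ (Fin d)} {R t : ℝ}

theorem massMeasure_eq_mongeAmpere (hR : ∀ i, ‖v i - q‖ = R) (hq : q ∈ convexHull ℝ (range v))
    (ht : 0 ≤ t) : massMeasure (minInner v) t = mongeAmpere (convexPotential (minInner v) t) := by
  have h0 : 0 ∈ convexHull ℝ (range fun i => v i - q) :=
    mem_convexHull_range_sub_iff.mpr (by rwa [zero_add])
  have hres := (isGradientFlow_lagrangianFlow hR).isResolvent (continuous_minInner _)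
    (exists_isSupergradient_eventually_eq hR h0) ht
  exact (isMongeAmpereMeasure_map hR ht hres).unique (isMongeAmpereMeasure_mongeAmpere hR ht)

theorem massMeasure_singleton_eq_zero (hR : ∀ i, ‖v i - q‖ = R) (hinj : Function.Injective v)
    (hspan : q ∈ affineSpan ℝ (range v)) (hq : q ∉ convexHull ℝ (range v)) (ht : 0 < t)
    (x : EuclideanSpace ℝ (Fin d)) : massMeasure (minInner v) t {x} = 0 := by
  have h0 : 0 ∉ convexHull ℝ (range fun i => v i - q) := by
    rwa [mem_convexHull_range_sub_iff, zero_add]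
  obtain ⟨m, e, hme⟩ := exists_isDriftFrame hR (sub_left_injective.comp hinj)
    (mem_affineSpan_range_sub_iff.mpr (by rwa [zero_add])) h0
  rw [massMeasure, Measure.map_apply (continuous_lagrangianFlow hR ht.le).measurable
    (measurableSet_singleton x)]
  simpa [preimage, sub_left_inj] using hme.measure_flow_fiber_eq_zero volume
    (isGradientFlow_lagrangianFlow hR) (fun a ha x => minInner_smul ha.le x) ht (x - t • q)

end ThreeVelocities

end Adhesion

end

open Adhesion in
/-- The first four conjuncts say that the viscous flows, their zero-viscosity limit, its
pushforward and the Monge-Ampère measures are well defined; the last three are the claims. -/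
theorem proposition6 (v : Fin 3 → EuclideanSpace ℝ (Fin 2)) (hv : AffineIndependent ℝ v)
    (q : EuclideanSpace ℝ (Fin 2))
    (hq : q = (⟨v, hv⟩ : Affine.Simplex ℝ (EuclideanSpace ℝ (Fin 2)) 2).circumcenter) :
    (∀ ε, 0 < ε → ∀ y, ∃ z, IsViscousPath (threeSector v) ε y z ∧
      ∀ z', IsViscousPath (threeSector v) ε y z' → Set.EqOn z' z (Set.Ici 0)) ∧
    (∀ t, 0 ≤ t → ∀ y, Tendsto (fun ε => viscousFlow (threeSector v) ε t y) (𝓝[>] 0)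
      (𝓝 (lagrangianFlow (threeSector v) t y))) ∧
    (∀ t, 0 ≤ t → Continuous (lagrangianFlow (threeSector v) t)) ∧
    (∀ t, 0 < t → IsMongeAmpereMeasure (convexPotential (threeSector v) t)
      (mongeAmpere (convexPotential (threeSector v) t))) ∧
    List.TFAE [
      q ∈ convexHull ℝ (Set.range v),
      ∀ t, 0 < t → massMeasure (threeSector v) t =
        mongeAmpere (convexPotential (threeSector v) t),
      ∃ t, 0 < t ∧ massMeasure (threeSector v) t =
        mongeAmpere (convexPotential (threeSector v) t)] ∧
    (q ∉ convexHull ℝ (Set.range v) →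
      ∀ t, 0 < t → ∀ x, massMeasure (threeSector v) t {x} = 0) ∧
    (∀ t, 0 < t → 0 < mongeAmpere (convexPotential (threeSector v) t) {t • q}) := by
  simp only [threeSector_eq_minInner]
  have hR : ∀ i, ‖v i - q‖ = (⟨v, hv⟩ : Affine.Simplex ℝ _ 2).circumradius := fun i => by
    rw [← dist_eq_norm, hq]
    exact Affine.Simplex.dist_circumcenter_eq_circumradius ⟨v, hv⟩ i
  have hspan : affineSpan ℝ (range v) = ⊤ :=
    hv.affineSpan_eq_top_iff_card_eq_finrank_add_one.mpr (by simp)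
  have hatom : q ∉ convexHull ℝ (range v) → ∀ t, 0 < t → ∀ x, massMeasure (minInner v) t {x} = 0 :=
    fun hq' t ht => massMeasure_singleton_eq_zero hR hv.injective (by simp [hspan]) hq' ht
  have hpos : ∀ t, 0 < t → 0 < mongeAmpere (convexPotential (minInner v) t) {t • q} :=
    fun t ht => mongeAmpere_singleton_pos hR hspan ht
  refine ⟨fun ε hε y => ?_, fun t ht => tendsto_viscousFlow hR ht,
    fun t ht => continuous_lagrangianFlow hR ht,
    fun t ht => isMongeAmpereMeasure_mongeAmpere hR ht.le, ?_, hatom, hpos⟩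
  · obtain ⟨L, hL⟩ := exists_lipschitzWith_minInner v
    have hz := isViscousPath_viscousFlow hL (concaveOn_minInner v) hε y
    exact ⟨_, hz, fun z' hz' => hz'.eqOn hL (concaveOn_minInner v) hε hz⟩
  · tfae_have 1 → 2 := fun h t ht => massMeasure_eq_mongeAmpere hR h ht.le
    tfae_have 2 → 3 := fun h => ⟨1, one_pos, h 1 one_pos⟩
    tfae_have 3 → 1 := fun ⟨t, ht, heq⟩ => not_not.mp fun hq' =>
      (hpos t ht).ne' (heq ▸ hatom hq' t ht (t • q))
    tfae_finish
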